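/- Let $n$ be a positive integer and let $\mathcal{C}$ be an additive and idempotent complete category (not assumed to be skeletally small). An $n$-kernel of a morphism $f : X \to Y$ of $\mathcal{C}$ is a sequence of morphisms $X_n \to \cdots \to X_1 \to X$ in $\mathcal{C}$ such that $0 \to \mathcal{C}(-,X_n) \to \cdots \to \mathcal{C}(-,X_1) \to \mathcal{C}(-,X) \to \mathcal{C}(-,Y)$ is exact (objectwise), and an $n$-cokernel of $f$ is defined dually. The category $\mathcal{C}$ is called $n$-abelian if every morphism of $\mathcal{C}$ has an $n$-kernel and an $n$-cokernel; for every monomorphism $f : X \to Y$ and every $n$-cokernel $Y \xrightarrow{g_1} Y_1 \to \cdots \xrightarrow{g_n} Y_n$ of $f$, the sequence $X \xrightarrow{f} Y \xrightarrow{g_1} \cdots \xrightarrow{g_{n-1}} Y_{n-1}$ is an $n$-kernel of $g_n$; and, dually, for every epimorphism $f : X \to Y$ and every $n$-kernel $X_n \xrightarrow{f_n} \cdots \xrightarrow{f_1} X$ of $f$, the sequence $X_{n-1} \xrightarrow{f_{n-1}} \cdots \xrightarrow{f_1} X \xrightarrow{f} Y$ is an $n$-cokernel of $f_n$. Let $\operatorname{mod}\mathcal{C}$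 be the category of finitely presented right $\mathcal{C}$-modules, that is, of the additive functors $F : \mathcal{C}^{\mathrm{op}} \to \mathrm{Ab}$ for which there is an (objectwise) exact sequence $\mathcal{C}(-,X) \xrightarrow{\mathcal{C}(-,f)} \mathcal{C}(-,Y) \to F \to 0$ for some morphism $f : X \to Y$ of $\mathcal{C}$, with all natural transformations as morphisms; $\operatorname{mod}\mathcal{C}^{\mathrm{op}}$ is the same construction for the opposite category $\mathcal{C}^{\mathrm{op}}$. The category $\mathcal{C}$ is called coherent if $\operatorname{mod}\mathcal{C}$ and $\operatorname{mod}\mathcal{C}^{\mathrm{op}}$ are both abelian categories. The global dimension $\operatorname{gl.dim}(\mathcal{A})$ of an abelian category $\mathcal{A}$ is the supremum of the projective dimensions of its objects, and the grade of an object $X$ of $\mathcal{A}$ is the supremum in $\mathbb{N} \cup \{\infty\}$ of the set of nonnegative integers $j$ such that $\operatorname{Ext}^i_{\mathcal{A}}(X,P) = 0$ for all $0 \le i < j$ and all projective objects $P$ of $\mathcal{A}$, where $\operatorname{Ext}^0_{\mathcal{A}}(X,P) = \mathcal{A}(X,P)$. Then $\mathcal{C}$ is $n$-abelian if and only if $\mathcal{C}$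 is coherent, $\operatorname{gl.dim}(\operatorname{mod}\mathcal{C}) \leq n+1$, and every nonzero object of $\operatorname{mod}\mathcal{C}$ and every nonzero object of $\operatorname{mod}\mathcal{C}^{\mathrm{op}}$ has grade either $0$ or $n+1$. -/

import Mathlib

open CategoryTheory CategoryTheory.Limits

universe v u

namespace HigherAbelian

/-! ### `n`-kernels, `n`-cokernels and `n`-abelian categories -/

section NAbelian

variable {C : Type u} [Category.{v} C] [Preadditive C] {n : ℕ}

/-- For a sequence `S₀ ⟶ S₁ ⟶ ⋯ ⟶ Sₙ ⟶ Sₙ₊₁`, the sequence of right modules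
`0 ⟶ C(-, S₀) ⟶ C(-, S₁) ⟶ ⋯ ⟶ C(-, Sₙ) ⟶ C(-, Sₙ₊₁)` is exact (objectwise), i.e. the first `n`
morphisms of `S` form an `n`-kernel of the last morphism of `S`. -/
structure IsNKernelSeq (S : ComposableArrows C (n + 1)) : Prop where
  /-- exactness at `C(-, S₀)` -/
  injective : ∀ A : C, Function.Injective (fun g : A ⟶ S.obj' 0 => g ≫ S.map' 0 1)
  /-- exactness at `C(-, Sᵢ₊₁)` for `0 ≤ i < n` -/
  exact : ∀ (i : ℕ) (hi : i < n) (A : C), Function.Exact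
    (fun g : A ⟶ S.obj' i => g ≫ S.map' i (i + 1))
    (fun g : A ⟶ S.obj' (i + 1) => g ≫ S.map' (i + 1) (i + 2))

/-- For a sequence `S₀ ⟶ S₁ ⟶ ⋯ ⟶ Sₙ ⟶ Sₙ₊₁`, the sequence of left modules
`0 ⟶ C(Sₙ₊₁, -) ⟶ C(Sₙ, -) ⟶ ⋯ ⟶ C(S₁, -) ⟶ C(S₀, -)` is exact (objectwise), i.e. the last `n`
morphisms of `S` form an `n`-cokernel of the first morphism of `S`. -/
structure IsNCokernelSeq (S : ComposableArrows C (n + 1)) : Prop where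
  /-- exactness at `C(Sₙ₊₁, -)` -/
  injective : ∀ A : C, Function.Injective (fun g : S.obj' (n + 1) ⟶ A => S.map' n (n + 1) ≫ g)
  /-- exactness at `C(Sᵢ₊₁, -)` for `0 ≤ i < n` -/
  exact : ∀ (i : ℕ) (hi : i < n) (A : C), Function.Exact
    (fun g : S.obj' (i + 2) ⟶ A => S.map' (i + 1) (i + 2) ≫ g)
    (fun g : S.obj' (i + 1) ⟶ A => S.map' i (i + 1) ≫ g)

variable (C n)

/-- Every morphism of `C` has an `n`-kernel. -/
def HasNKernels : Prop :=
  ∀ ⦃X Y : C⦄ (f : X ⟶ Y), ∃ S : ComposableArrows C (n + 1),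
    Arrow.mk (S.map' n (n + 1)) = Arrow.mk f ∧ IsNKernelSeq S

/-- Every morphism of `C` has an `n`-cokernel. -/
def HasNCokernels : Prop :=
  ∀ ⦃X Y : C⦄ (f : X ⟶ Y), ∃ S : ComposableArrows C (n + 1),
    Arrow.mk (S.map' 0 1) = Arrow.mk f ∧ IsNCokernelSeq S

/-- The axioms of an `n`-abelian category, for an additive and idempotent complete
category `C`. -/
structure IsNAbelian : Prop where
  hasNKernels : HasNKernels C n
  hasNCokernels : HasNCokernels C n
  /-- If `S₀ ⟶ S₁` is a monomorphism with `n`-cokernel `S₁ ⟶ ⋯ ⟶ Sₙ₊₁`, then `S₀ ⟶ ⋯ ⟶ Sₙ` is an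
  `n`-kernel of `Sₙ ⟶ Sₙ₊₁`. -/
  isNKernelSeq_of_mono : ∀ S : ComposableArrows C (n + 1),
    Mono (S.map' 0 1) → IsNCokernelSeq S → IsNKernelSeq S
  /-- If `Sₙ ⟶ Sₙ₊₁` is an epimorphism with `n`-kernel `S₀ ⟶ ⋯ ⟶ Sₙ`, then `S₁ ⟶ ⋯ ⟶ Sₙ₊₁` is an
  `n`-cokernel of `S₀ ⟶ S₁`. -/
  isNCokernelSeq_of_epi : ∀ S : ComposableArrows C (n + 1),
    Epi (S.map' n (n + 1)) → IsNKernelSeq S → IsNCokernelSeq S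

end NAbelian

/-! ### Finitely presented modules over a category -/

section Modules

variable (C : Type u) [Category.{v} C] [Preadditive C]

/-- A right `C`-module (an additive functor `Cᵒᵖ ⥤ Ab`) `F` is finitely presented if there is an
(objectwise) exact sequence `C(-, X) ⟶ C(-, Y) ⟶ F ⟶ 0` induced by some `f : X ⟶ Y`. -/
def isFinitelyPresented : ObjectProperty (Cᵒᵖ ⥤ AddCommGrpCat.{v}) := fun F =>
  F.Additive ∧ ∃ (X Y : C) (f : X ⟶ Y) (p : preadditiveYoneda.obj Y ⟶ F), ∀ A : Cᵒᵖ,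
    Function.Exact ((preadditiveYoneda.map f).app A) (p.app A) ∧ Function.Surjective (p.app A)

/-- The category `mod C` of finitely presented right `C`-modules and all natural transformations.
Left `C`-modules are right `Cᵒᵖ`-modules, so that `mod Cᵒᵖ` is `FPMod Cᵒᵖ`. -/
abbrev FPMod := (isFinitelyPresented C).FullSubcategory

end Modules

/-! ### Abelian categories, coherence, global dimension and grade -/

/-- A preadditive category is abelian (as a property). -/
structure IsAbelianCategory (A : Type u) [Category.{v} A] [Preadditive A] : Prop where
  isNormalMonoCategory : IsNormalMonoCategory A
  isNormalEpiCategory : IsNormalEpiCategory A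
  hasFiniteProducts : HasFiniteProducts A
  hasKernels : HasKernels A
  hasCokernels : HasCokernels A

/-- The bundled form of `IsAbelianCategory`, extending the given preadditive structure. -/
abbrev IsAbelianCategory.abelian {A : Type u} [Category.{v} A] [Preadditive A]
    (h : IsAbelianCategory A) : Abelian A :=
  { (inferInstance : Preadditive A), h.isNormalMonoCategory, h.isNormalEpiCategory with
    has_finite_products := h.hasFiniteProducts
    has_kernels := h.hasKernels
    has_cokernels := h.hasCokernels }

/-- `C` is coherent: it is right coherent (`mod C` is abelian) and left coherent (`mod Cᵒᵖ` is
abelian). -/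
structure IsCoherent (C : Type u) [Category.{v} C] [Preadditive C] : Prop where
  right : IsAbelianCategory (FPMod C)
  left : IsAbelianCategory (FPMod Cᵒᵖ)

section Dimensions

variable (A : Type u) [Category.{v} A] [Abelian A]

/-- The global dimension of an abelian category: the supremum of the projective dimensions of its
objects (the projective dimension of a zero object is `⊥`). -/
noncomputable def gldim : WithBot ℕ∞ := ⨆ X : A, projectiveDimension X

variable {A}

/-- The grade of an object `X` of an abelian category: the supremum in `ℕ∞` of the natural numbers
`j` such that `Extⁱ(X, P) = 0` for all `i < j` and all projective objects `P`. -/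
noncomputable def grade (X : A) : ℕ∞ :=
  letI := HasExt.standard A
  ⨆ j ∈ {j : ℕ | ∀ i < j, ∀ P : A, Projective P → Subsingleton (Abelian.Ext.{max u v} X P i)},
    (j : ℕ∞)

end Dimensions

end HigherAbelian

namespace HigherAbelian

/-! ### Morphisms up to equality in the arrow category -/

section Arrows

variable {C : Type u} [Category.{v} C]

/-! The Yoneda embedding turns the objects of `C` into projectives of `mod C`, and every finitely
presented module is the cokernel of a map between two of them; `IsPresentationFunctor` isolates this
situation. The category `mod C` is abelian exactly when `C` has weak kernels
(`isAbelianCategory_fpMod_iff`). Iterated weak kernels of `f` then resolve `coker C(-, f)` by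
projectives, and the axioms on `C` become homological conditions.

An `n`-kernel is a projective resolution of length `n + 1`, so `n`-kernels bound the global
dimension. Conversely, the bound makes a high syzygy projective, hence some weak kernel von Neumann
regular; splitting an idempotent then replaces the weak kernel after it by a monomorphism
(`IsPresentationFunctor.hasNKernels`).

Mapping such a resolution into representables computes `Ext`, so a sequence of weak kernels is an
`n`-cokernel sequence iff `Extⁱ(-, P)` of the resolved module vanishes for `i ≤ n` and `P`
projective (`isNCokernelSeq_iff`); for `i = 0` this says that `f` is epi. A nonzero module of
projective dimension at most `n + 1` cannot have these groups vanish for all `i ≤ n + 1`. Thus the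
grade condition on `mod C` is the axiom on epimorphisms (`grade_iff`), and the axiom on
monomorphisms is the same statement over `Cᵒᵖ`.

Only `mod C` has its global dimension bounded, so `n`-cokernels in `C` need another argument:
`n`-kernels in `C` are `n`-cokernels in `Cᵒᵖ`, where a null-homotopy (`exists_homotopy`) again
yields a regular weak kernel, so that weak kernels improve to `n`-kernels
(`HasWeakKernels.hasNKernels`). -/

lemma forall_injective_comp_iff_mono {X Y : C} (f : X ⟶ Y) :
    (∀ A : C, Function.Injective (fun g : A ⟶ X => g ≫ f)) ↔ Mono f :=
  ⟨fun h => ⟨fun _ _ w => h _ w⟩, fun _ _ _ _ w => (cancel_mono f).1 w⟩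

lemma forall_injective_comp_iff_epi {X Y : C} (f : X ⟶ Y) :
    (∀ A : C, Function.Injective (fun g : Y ⟶ A => f ≫ g)) ↔ Epi f :=
  ⟨fun h => ⟨fun _ _ w => h _ w⟩, fun _ _ _ _ w => (cancel_epi f).1 w⟩

/-- A property of morphisms only depends on the corresponding object of `Arrow C`. -/
lemma iff_of_arrow_eq (P : ∀ ⦃X Y : C⦄, (X ⟶ Y) → Prop) {X Y X' Y' : C} {f : X ⟶ Y}
    {g : X' ⟶ Y'} (h : Arrow.mk f = Arrow.mk g) : P f ↔ P g :=
  iff_of_eq (congrArg (fun a : Arrow C => P a.hom) h)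

lemma exists_iso_of_arrow_eq {X Y X' Y' : C} {f : X ⟶ Y} {g : X' ⟶ Y'}
    (h : Arrow.mk f = Arrow.mk g) :
    ∃ (a : X ≅ X') (b : Y ≅ Y'), f ≫ b.hom = a.hom ≫ g :=
  (iff_of_arrow_eq (fun V W f' => ∃ (a : V ≅ X') (b : W ≅ Y'), f' ≫ b.hom = a.hom ≫ g) h).2
    ⟨.refl _, .refl _, by simp⟩

end Arrows

/-! ### Weak kernels and weak pullbacks -/

section WeakKernels

variable {C : Type u} [Category.{v} C] [Preadditive C]

/-- `k` is a weak kernel of `f`: the sequence `C(-, K) ⟶ C(-, X) ⟶ C(-, Y)` is exact. -/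
def IsWeakKernel {K X Y : C} (k : K ⟶ X) (f : X ⟶ Y) : Prop :=
  ∀ A : C, Function.Exact (fun g : A ⟶ K => g ≫ k) (fun g : A ⟶ X => g ≫ f)

lemma IsWeakKernel.w {K X Y : C} {k : K ⟶ X} {f : X ⟶ Y} (h : IsWeakKernel k f) : k ≫ f = 0 :=
  (h K k).2 ⟨𝟙 K, by simp⟩

lemma IsWeakKernel.exists_lift {K X Y : C} {k : K ⟶ X} {f : X ⟶ Y} (h : IsWeakKernel k f)
    {A : C} (a : A ⟶ X) (ha : a ≫ f = 0) : ∃ l : A ⟶ K, l ≫ k = a :=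
  (h A a).1 ha

lemma IsWeakKernel.mk {K X Y : C} {k : K ⟶ X} {f : X ⟶ Y} (w : k ≫ f = 0)
    (h : ∀ (A : C) (a : A ⟶ X), a ≫ f = 0 → ∃ l : A ⟶ K, l ≫ k = a) : IsWeakKernel k f := by
  refine fun A a => ⟨h A a, ?_⟩
  rintro ⟨l, rfl⟩
  simp [w]

variable (C) in
/-- Every morphism of `C` has a weak kernel. -/
def HasWeakKernels : Prop :=
  ∀ ⦃X Y : C⦄ (f : X ⟶ Y), ∃ (K : C) (k : K ⟶ X), IsWeakKernel k f

/-- A weak kernel of `f - g`, in the form of a weak pullback. -/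
lemma HasWeakKernels.exists_weakPullback [HasFiniteBiproducts C] (hC : HasWeakKernels C)
    {X Y Z : C} (f : X ⟶ Z) (g : Y ⟶ Z) :
    ∃ (W : C) (p : W ⟶ X) (q : W ⟶ Y), p ≫ f = q ≫ g ∧
      ∀ (A : C) (a : A ⟶ X) (b : A ⟶ Y), a ≫ f = b ≫ g → ∃ l : A ⟶ W, l ≫ p = a ∧ l ≫ q = b := by
  have := hasBinaryBiproducts_of_finite_biproducts C
  obtain ⟨W, k, hk⟩ := hC (biprod.desc f (-g))
  refine ⟨W, k ≫ biprod.fst, k ≫ biprod.snd, ?_, fun A a b hab => ?_⟩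
  · have := hk.w
    rw [← sub_eq_zero, ← this]
    simp [biprod.desc_eq, sub_eq_add_neg]
  · obtain ⟨l, hl⟩ := hk.exists_lift (biprod.lift a b) (by simp [hab])
    exact ⟨l, by simp [reassoc_of% hl], by simp [reassoc_of% hl]⟩

end WeakKernels

/-! ### Sequences of weak kernels and opposite sequences -/

section Sequences

open ComposableArrows

variable {C : Type u} [Category.{v} C] [Preadditive C] {n : ℕ}

/-- Each morphism of the sequence is a weak kernel of the next one. -/
def IsWeakKernelSeq (S : ComposableArrows C (n + 1)) : Prop :=
  ∀ (i : ℕ) (hi : i < n), IsWeakKernel (S.map' i (i + 1)) (S.map' (i + 1) (i + 2))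

lemma isNKernelSeq_iff (S : ComposableArrows C (n + 1)) :
    IsNKernelSeq S ↔ Mono (S.map' 0 1) ∧ IsWeakKernelSeq S := by
  rw [← forall_injective_comp_iff_mono]
  exact ⟨fun h => ⟨h.1, h.2⟩, fun h => ⟨h.1, h.2⟩⟩

lemma IsWeakKernelSeq.precomp {S : ComposableArrows C (n + 1)} (hS : IsWeakKernelSeq S) {X : C}
    (f : X ⟶ S.left) (hf : IsWeakKernel f (S.map' 0 1)) :
    IsWeakKernelSeq (S.precomp f) := by
  rintro (_ | i) hi
  · exact hf
  · exact hS i (by lia)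

lemma HasWeakKernels.exists_isWeakKernelSeq (hC : HasWeakKernels C) (m : ℕ) {X Y : C}
    (f : X ⟶ Y) : ∃ S : ComposableArrows C (m + 1),
      Arrow.mk (S.map' m (m + 1)) = Arrow.mk f ∧ IsWeakKernelSeq S := by
  induction m with
  | zero => exact ⟨mk₁ f, rfl, fun i hi => by lia⟩
  | succ m ih =>
    obtain ⟨S, hS, hS'⟩ := ih
    obtain ⟨K, k, hk⟩ := hC (S.map' 0 1)
    exact ⟨S.precomp k, hS, hS'.precomp k hk⟩

lemma HasNKernels.hasWeakKernels (h : HasNKernels C n) (hn : 0 < n) : HasWeakKernels C := by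
  intro X Y f
  obtain ⟨S, hS, hS'⟩ := h f
  obtain ⟨m, rfl⟩ : ∃ m, n = m + 1 := ⟨n - 1, by lia⟩
  refine (iff_of_arrow_eq (fun X Y f => ∃ (K : C) (k : K ⟶ X), IsWeakKernel k f) hS).1 ?_
  exact ⟨_, S.map' m (m + 1), fun A => hS'.exact m (by lia) A⟩

/-- The opposite of a sequence of morphisms. -/
def opSeq (S : ComposableArrows C n) : ComposableArrows Cᵒᵖ n where
  obj i := Opposite.op (S.obj i.rev)
  map f := (S.map (homOfLE (Fin.rev_le_rev.2 (leOfHom f)))).op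
  map_id i := congrArg Quiver.Hom.op (S.map_id i.rev)
  map_comp f g := by rw [← op_comp, ← S.map_comp]; rfl

/-- The sequence of morphisms in `C` given by a sequence of morphisms in `Cᵒᵖ`. -/
def unopSeq (S : ComposableArrows Cᵒᵖ n) : ComposableArrows C n where
  obj i := (S.obj i.rev).unop
  map f := (S.map (homOfLE (Fin.rev_le_rev.2 (leOfHom f)))).unop
  map_id i := congrArg Quiver.Hom.unop (S.map_id i.rev)
  map_comp f g := by rw [← unop_comp, ← S.map_comp]; rfl

end Sequences
-- Duality between `n`-kernels and `n`-cokernels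
section Duality

variable {C : Type u} [Category.{v} C] [Preadditive C] {n : ℕ}

/-- Indices are variables tied by equations because reversing a sequence produces indices such as `n
+ 1 + 1 - (i + 1)`, which agree with the expected ones only up to arithmetic. -/
lemma isNKernelSeq_iff' (S : ComposableArrows C (n + 1)) :
    IsNKernelSeq S ↔ (∀ i j (_ : i = 0) (_ : j = 1), Mono (S.map' i j)) ∧
      ∀ (i j k : ℕ) (_ : i + 1 = j) (_ : j + 1 = k) (_ : k ≤ n + 1) (A : C), Function.Exact
        (fun g : A ⟶ S.obj' i => g ≫ S.map' i j) (fun g : A ⟶ S.obj' j => g ≫ S.map' j k) := by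
  rw [isNKernelSeq_iff]
  refine and_congr ⟨?_, fun h => h _ _ rfl rfl⟩ ⟨?_, fun h i hi => h _ _ _ rfl rfl (by lia)⟩
  · rintro h i j rfl rfl
    exact h
  · rintro h i j k rfl rfl hk A
    exact h i (by lia) A

lemma isNCokernelSeq_iff' (S : ComposableArrows C (n + 1)) :
    IsNCokernelSeq S ↔ (∀ i j (_ : i = n) (_ : j = n + 1), Epi (S.map' i j)) ∧
      ∀ (i j k : ℕ) (_ : i + 1 = j) (_ : j + 1 = k) (_ : k ≤ n + 1) (A : C), Function.Exact
        (fun g : S.obj' k ⟶ A => S.map' j k ≫ g) (fun g : S.obj' j ⟶ A => S.map' i j ≫ g) := by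
  constructor
  · rintro ⟨h, h'⟩
    constructor
    · rintro i j rfl rfl
      exact (forall_injective_comp_iff_epi _).1 h
    · rintro i j k rfl rfl hk A
      exact h' i (by lia) A
  · rintro ⟨h, h'⟩
    exact ⟨(forall_injective_comp_iff_epi _).2 (h _ _ rfl rfl),
      fun i hi => h' _ _ _ rfl rfl (by lia)⟩

lemma exact_comp_op_iff {X Y Z : C} (f : X ⟶ Y) (g : Y ⟶ Z) :
    (∀ A : Cᵒᵖ, Function.Exact (fun x : A ⟶ .op Z => x ≫ g.op) (fun x : A ⟶ .op Y => x ≫ f.op)) ↔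
      ∀ A : C, Function.Exact (fun x : Z ⟶ A => g ≫ x) (fun x : Y ⟶ A => f ≫ x) := by
  constructor
  · intro h A x
    refine Iff.trans ?_ ((h (.op A) x.op).trans ?_)
    · exact ⟨fun h => congrArg Quiver.Hom.op h, fun h => Quiver.Hom.op_inj h⟩
    · exact ⟨fun ⟨y, hy⟩ => ⟨y.unop, Quiver.Hom.op_inj hy⟩, fun ⟨y, hy⟩ => ⟨y.op, congrArg _ hy⟩⟩
  · intro h A x
    refine Iff.trans ?_ ((h A.unop x.unop).trans ?_)
    · exact ⟨fun h => congrArg Quiver.Hom.unop h, fun h => Quiver.Hom.unop_inj h⟩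
    · exact ⟨fun ⟨y, hy⟩ => ⟨y.op, congrArg Quiver.Hom.op hy⟩,
        fun ⟨y, hy⟩ => ⟨y.unop, congrArg Quiver.Hom.unop hy⟩⟩

lemma exact_op_comp_iff {X Y Z : C} (f : X ⟶ Y) (g : Y ⟶ Z) :
    (∀ A : Cᵒᵖ, Function.Exact (fun x : .op X ⟶ A => f.op ≫ x) (fun x : .op Y ⟶ A => g.op ≫ x)) ↔
      ∀ A : C, Function.Exact (fun x : A ⟶ X => x ≫ f) (fun x : A ⟶ Y => x ≫ g) := by
  constructor
  · intro h A x
    refine Iff.trans ?_ ((h (.op A) x.op).trans ?_)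
    · exact ⟨fun h => congrArg Quiver.Hom.op h, fun h => Quiver.Hom.op_inj h⟩
    · exact ⟨fun ⟨y, hy⟩ => ⟨y.unop, Quiver.Hom.op_inj hy⟩, fun ⟨y, hy⟩ => ⟨y.op, congrArg _ hy⟩⟩
  · intro h A x
    refine Iff.trans ?_ ((h A.unop x.unop).trans ?_)
    · exact ⟨fun h => congrArg Quiver.Hom.unop h, fun h => Quiver.Hom.unop_inj h⟩
    · exact ⟨fun ⟨y, hy⟩ => ⟨y.op, congrArg Quiver.Hom.op hy⟩,
        fun ⟨y, hy⟩ => ⟨y.unop, congrArg Quiver.Hom.unop hy⟩⟩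

lemma isNKernelSeq_opSeq {S : ComposableArrows C (n + 1)} (hS : IsNCokernelSeq S) :
    IsNKernelSeq (opSeq S) := by
  rw [isNCokernelSeq_iff'] at hS
  rw [isNKernelSeq_iff']
  constructor
  · rintro i j rfl rfl
    have := hS.1 (n + 1 + 1 - (1 + 1)) (n + 1 + 1 - (0 + 1)) (by lia) (by lia)
    exact inferInstanceAs (Mono (S.map' (n + 1 + 1 - (1 + 1)) (n + 1 + 1 - (0 + 1))).op)
  · intro i j k hij hjk hk
    exact (exact_comp_op_iff _ _).2 (hS.2 (n + 1 + 1 - (k + 1)) (n + 1 + 1 - (j + 1))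
      (n + 1 + 1 - (i + 1)) (by lia) (by lia) (by lia))

lemma isNCokernelSeq_opSeq {S : ComposableArrows C (n + 1)} (hS : IsNKernelSeq S) :
    IsNCokernelSeq (opSeq S) := by
  rw [isNKernelSeq_iff'] at hS
  rw [isNCokernelSeq_iff']
  constructor
  · intro i j hi hj
    have := hS.1 (n + 1 + 1 - (j + 1)) (n + 1 + 1 - (i + 1)) (by lia) (by lia)
    exact inferInstanceAs (Epi (S.map' (n + 1 + 1 - (j + 1)) (n + 1 + 1 - (i + 1))).op)
  · intro i j k hij hjk hk
    exact (exact_op_comp_iff _ _).2 (hS.2 (n + 1 + 1 - (k + 1)) (n + 1 + 1 - (j + 1))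
      (n + 1 + 1 - (i + 1)) (by lia) (by lia) (by lia))

lemma isNKernelSeq_unopSeq {S : ComposableArrows Cᵒᵖ (n + 1)} (hS : IsNCokernelSeq S) :
    IsNKernelSeq (unopSeq S) := by
  rw [isNCokernelSeq_iff'] at hS
  rw [isNKernelSeq_iff']
  constructor
  · rintro i j rfl rfl
    have := hS.1 (n + 1 + 1 - (1 + 1)) (n + 1 + 1 - (0 + 1)) (by lia) (by lia)
    exact inferInstanceAs (Mono (S.map' (n + 1 + 1 - (1 + 1)) (n + 1 + 1 - (0 + 1))).unop)
  · intro i j k hij hjk hk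
    exact (exact_op_comp_iff (Quiver.Hom.unop _) (Quiver.Hom.unop _)).1
      (hS.2 (n + 1 + 1 - (k + 1)) (n + 1 + 1 - (j + 1))
      (n + 1 + 1 - (i + 1)) (by lia) (by lia) (by lia))

lemma isNCokernelSeq_unopSeq {S : ComposableArrows Cᵒᵖ (n + 1)} (hS : IsNKernelSeq S) :
    IsNCokernelSeq (unopSeq S) := by
  rw [isNKernelSeq_iff'] at hS
  rw [isNCokernelSeq_iff']
  constructor
  · intro i j hi hj
    have := hS.1 (n + 1 + 1 - (j + 1)) (n + 1 + 1 - (i + 1)) (by lia) (by lia)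
    exact inferInstanceAs (Epi (S.map' (n + 1 + 1 - (j + 1)) (n + 1 + 1 - (i + 1))).unop)
  · intro i j k hij hjk hk
    exact (exact_comp_op_iff (Quiver.Hom.unop _) (Quiver.Hom.unop _)).1
      (hS.2 (n + 1 + 1 - (k + 1)) (n + 1 + 1 - (j + 1))
      (n + 1 + 1 - (i + 1)) (by lia) (by lia) (by lia))

end Duality
section Duality

variable {C : Type u} [Category.{v} C] [Preadditive C] {n : ℕ}

lemma HasNCokernels.op (h : HasNCokernels C n) : HasNKernels Cᵒᵖ n := by
  intro X Y f
  obtain ⟨S, hS, hS'⟩ := h f.unop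
  refine ⟨opSeq S, ?_, isNKernelSeq_opSeq hS'⟩
  have key : ∀ i j (_ : i = 0) (_ : j = 1), Arrow.mk (S.map' i j).op = Arrow.mk f := by
    rintro i j rfl rfl
    exact congrArg (fun a : Arrow C => Arrow.mk a.hom.op) hS
  exact key (n + 1 + 1 - (n + 1 + 1)) (n + 1 + 1 - (n + 1)) (by lia) (by lia)

lemma HasNKernels.op (h : HasNKernels C n) : HasNCokernels Cᵒᵖ n := by
  intro X Y f
  obtain ⟨S, hS, hS'⟩ := h f.unop
  refine ⟨opSeq S, ?_, isNCokernelSeq_opSeq hS'⟩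
  have key : ∀ i j (_ : i = n) (_ : j = n + 1), Arrow.mk (S.map' i j).op = Arrow.mk f := by
    rintro i j rfl rfl
    exact congrArg (fun a : Arrow C => Arrow.mk a.hom.op) hS
  exact key (n + 1 + 1 - (1 + 1)) (n + 1 + 1 - (0 + 1)) (by lia) (by lia)

lemma HasNKernels.unop (h : HasNKernels Cᵒᵖ n) : HasNCokernels C n := by
  intro X Y f
  obtain ⟨S, hS, hS'⟩ := h f.op
  refine ⟨unopSeq S, ?_, isNCokernelSeq_unopSeq hS'⟩
  have key : ∀ i j (_ : i = n) (_ : j = n + 1), Arrow.mk (S.map' i j).unop = Arrow.mk f := by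
    rintro i j rfl rfl
    exact congrArg (fun a : Arrow Cᵒᵖ => Arrow.mk a.hom.unop) hS
  exact key (n + 1 + 1 - (1 + 1)) (n + 1 + 1 - (0 + 1)) (by lia) (by lia)

variable (C n) in
/-- Every `n`-kernel of an epimorphism has this epimorphism as part of an `n`-cokernel. -/
def NKernelsOfEpiAreNCokernels : Prop :=
  ∀ S : ComposableArrows C (n + 1),
    Epi (S.map' n (n + 1)) → IsNKernelSeq S → IsNCokernelSeq S

/-- Reversing twice restores each index only propositionally, so the conditions are transported
along index equalities. -/
lemma isNCokernelSeq_of_opSeq_unopSeq {S : ComposableArrows Cᵒᵖ (n + 1)}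
    (h : IsNCokernelSeq (opSeq (unopSeq S))) : IsNCokernelSeq S := by
  rw [isNCokernelSeq_iff'] at h ⊢
  have key₁ : ∀ i j i' j' (_ : i' = i) (_ : j' = j) (hij : i ≤ j) (hj : j ≤ n + 1),
      Epi (S.map' i' j') → Epi (S.map' i j) := by
    rintro i j _ _ rfl rfl _ _ h
    exact h
  have key₂ : ∀ i j k i' j' k' (_ : i' = i) (_ : j' = j) (_ : k' = k) (hij : i ≤ j) (hjk : j ≤ k)
      (hk : k ≤ n + 1) (A : Cᵒᵖ), Function.Exact
        (fun g : S.obj' k' ⟶ A => S.map' j' k' ≫ g)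
        (fun g : S.obj' j' ⟶ A => S.map' i' j' ≫ g) → Function.Exact
        (fun g : S.obj' k ⟶ A => S.map' j k ≫ g) (fun g : S.obj' j ⟶ A => S.map' i j ≫ g) := by
    rintro i j k _ _ _ rfl rfl rfl _ _ _ A h
    exact h
  refine ⟨fun i j hi hj => ?_, fun i j k hij hjk hk A => ?_⟩
  · exact key₁ i j (n + 1 + 1 - (n + 1 + 1 - (i + 1) + 1)) (n + 1 + 1 - (n + 1 + 1 - (j + 1) + 1))
      (by lia) (by lia) (by lia) (by lia) (h.1 i j hi hj)
  · exact key₂ i j k (n + 1 + 1 - (n + 1 + 1 - (i + 1) + 1))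
      (n + 1 + 1 - (n + 1 + 1 - (j + 1) + 1)) (n + 1 + 1 - (n + 1 + 1 - (k + 1) + 1))
      (by lia) (by lia) (by lia) (by lia) (by lia) (by lia) A (h.2 i j k hij hjk hk A)

lemma isNKernelSeq_of_unopSeq_opSeq {S : ComposableArrows C (n + 1)}
    (h : IsNKernelSeq (unopSeq (opSeq S))) : IsNKernelSeq S := by
  rw [isNKernelSeq_iff'] at h ⊢
  have key₁ : ∀ i j i' j' (_ : i' = i) (_ : j' = j) (hij : i ≤ j) (hj : j ≤ n + 1),
      Mono (S.map' i' j') → Mono (S.map' i j) := by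
    rintro i j _ _ rfl rfl _ _ h
    exact h
  have key₂ : ∀ i j k i' j' k' (_ : i' = i) (_ : j' = j) (_ : k' = k) (hij : i ≤ j) (hjk : j ≤ k)
      (hk : k ≤ n + 1) (A : C), Function.Exact
        (fun g : A ⟶ S.obj' i' => g ≫ S.map' i' j')
        (fun g : A ⟶ S.obj' j' => g ≫ S.map' j' k') → Function.Exact
        (fun g : A ⟶ S.obj' i => g ≫ S.map' i j) (fun g : A ⟶ S.obj' j => g ≫ S.map' j k) := by
    rintro i j k _ _ _ rfl rfl rfl _ _ _ A h
    exact h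
  refine ⟨fun i j hi hj => ?_, fun i j k hij hjk hk A => ?_⟩
  · exact key₁ i j (n + 1 + 1 - (n + 1 + 1 - (i + 1) + 1)) (n + 1 + 1 - (n + 1 + 1 - (j + 1) + 1))
      (by lia) (by lia) (by lia) (by lia) (h.1 i j hi hj)
  · exact key₂ i j k (n + 1 + 1 - (n + 1 + 1 - (i + 1) + 1))
      (n + 1 + 1 - (n + 1 + 1 - (j + 1) + 1)) (n + 1 + 1 - (n + 1 + 1 - (k + 1) + 1))
      (by lia) (by lia) (by lia) (by lia) (by lia) (by lia) A (h.2 i j k hij hjk hk A)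

lemma IsNAbelian.nKernelsOfEpiAreNCokernels_op (h : IsNAbelian C n) :
    NKernelsOfEpiAreNCokernels Cᵒᵖ n := by
  intro S hS hS'
  have key : ∀ i j (_ : i = n) (_ : j = n + 1), Mono (S.map' i j).unop := by
    rintro i j rfl rfl
    exact unop_mono_of_epi _
  exact isNCokernelSeq_of_opSeq_unopSeq (isNCokernelSeq_opSeq (h.isNKernelSeq_of_mono (unopSeq S)
    (key (n + 1 + 1 - (1 + 1)) (n + 1 + 1 - (0 + 1)) (by lia) (by lia))
    (isNCokernelSeq_unopSeq hS')))

lemma NKernelsOfEpiAreNCokernels.isNKernelSeq_of_mono (h : NKernelsOfEpiAreNCokernels Cᵒᵖ n)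
    (S : ComposableArrows C (n + 1)) (hS : Mono (S.map' 0 1)) (hS' : IsNCokernelSeq S) :
    IsNKernelSeq S := by
  have key : ∀ i j (_ : i = 0) (_ : j = 1), Epi (S.map' i j).op := by
    rintro i j rfl rfl
    exact op_epi_of_mono _
  exact isNKernelSeq_of_unopSeq_opSeq (isNKernelSeq_unopSeq (h (opSeq S)
    (key (n + 1 + 1 - (n + 1 + 1)) (n + 1 + 1 - (n + 1)) (by lia) (by lia))
    (isNKernelSeq_opSeq hS')))

end Duality

/-! ### Null-homotopies and von Neumann regularity -/

section VanishingHomotopy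

variable {C : Type u} [Category.{v} C] [Preadditive C] {n : ℕ}

/-- A morphism in degrees `j` and `j + 1` from an `n`-cokernel sequence to a sequence of weak
kernels is null-homotopic in degree `j`, if the latter sequence is long enough. -/
lemma exists_homotopy {R : ComposableArrows C (n + 1)} (hR : IsNCokernelSeq R)
    {T : ComposableArrows C (n + 2 + 1)} (hT : IsWeakKernelSeq T) (k : ℕ) :
    ∀ (j : ℕ) (hj : j + k = n) (φ : R.obj' j ⟶ T.obj' (j + 1))
      (φ' : R.obj' (j + 1) ⟶ T.obj' (j + 2))
      (_ : φ ≫ T.map' (j + 1) (j + 2) = R.map' j (j + 1) ≫ φ'),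
      ∃ (s : R.obj' j ⟶ T.obj' j) (s' : R.obj' (j + 1) ⟶ T.obj' (j + 1)),
        φ = R.map' j (j + 1) ≫ s' + s ≫ T.map' j (j + 1) := by
  induction k with
  | zero =>
    rintro j rfl φ φ' w
    have : Epi (R.map' j (j + 1)) := (forall_injective_comp_iff_epi _).1 hR.injective
    -- The last morphism of `R` is epi, so the chain map continues by zero beyond degree `j + 1`.
    have h₁ : φ' ≫ T.map' (j + 2) (j + 3) = 0 := by
      apply this.left_cancellation
      rw [← reassoc_of% w, (hT (j + 1) (by lia)).w]
      simp
    obtain ⟨s', hs'⟩ := (hT (j + 1) (by lia)).exists_lift φ' h₁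
    obtain ⟨s, hs⟩ := (hT j (by lia)).exists_lift (φ - R.map' j (j + 1) ≫ s') (by
      rw [Preadditive.sub_comp, w, Category.assoc, hs', sub_self])
    exact ⟨s, s', by rw [hs]; abel⟩
  | succ k ih =>
    rintro j hj φ φ' w
    -- Exactness of `R` extends the chain map one degree to the right; the homotopy found there is
    -- then continued to the left.
    obtain ⟨φ'', hφ''⟩ := (hR.exact j (by lia) _ (φ' ≫ T.map' (j + 2) (j + 3))).1 (by
      dsimp only
      rw [← reassoc_of% w, (hT (j + 1) (by lia)).w, comp_zero])
    obtain ⟨s', s'', h⟩ := ih (j + 1) (by lia) φ' φ'' hφ''.symm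
    have w' : R.map' j (j + 1) ≫ R.map' (j + 1) (j + 2) = 0 :=
      (hR.exact j (by lia) _ (R.map' (j + 1) (j + 2))).2 ⟨𝟙 _, by simp⟩
    obtain ⟨s, hs⟩ := (hT j (by lia)).exists_lift (φ - R.map' j (j + 1) ≫ s') (by
      rw [Preadditive.sub_comp, w, Category.assoc, h, Preadditive.comp_add, reassoc_of% w']
      simp)
    exact ⟨s, s', by rw [hs]; abel⟩

/-- If `C` has `n`-cokernels, then the second morphism of a sequence of `n + 3` morphisms, each a
weak kernel of the next, is von Neumann regular. -/
lemma HasNCokernels.exists_regular (h : HasNCokernels C n) {T : ComposableArrows C (n + 2 + 1)}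
    (hT : IsWeakKernelSeq T) :
    ∃ ψ : T.obj' 2 ⟶ T.obj' 1, T.map' 1 2 ≫ ψ ≫ T.map' 1 2 = T.map' 1 2 := by
  obtain ⟨R, hR, hR'⟩ := h (T.map' 1 2)
  obtain ⟨a, b, hab⟩ := exists_iso_of_arrow_eq hR
  -- Essentially the identity of the second morphism of `T`: in degree 0 it becomes `𝟙 = d ≫ s' + s
  -- ≫ d₀` with `d₀ ≫ d = 0`, and composing with `d` gives regularity.
  obtain ⟨s, s', hs⟩ := exists_homotopy hR' hT n 0 (by lia) a.hom b.hom hab.symm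
  refine ⟨b.inv ≫ s', ?_⟩
  have h₂ : a.inv ≫ R.map' 0 1 = T.map' 1 2 ≫ b.inv := by
    rw [Iso.inv_comp_eq, ← reassoc_of% hab, b.hom_inv_id, Category.comp_id]
  have h₃ : T.map' 0 1 ≫ T.map' 1 2 = 0 := (hT 0 (by lia)).w
  have h₄ : 𝟙 _ = T.map' 1 2 ≫ b.inv ≫ s' + a.inv ≫ s ≫ T.map' 0 1 := by
    rw [← reassoc_of% h₂, ← Preadditive.comp_add, ← hs, a.inv_hom_id]
  calc _ = (T.map' 1 2 ≫ b.inv ≫ s' + a.inv ≫ s ≫ T.map' 0 1) ≫ T.map' 1 2 := by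
        simp only [Preadditive.add_comp, Category.assoc, h₃, comp_zero, add_zero]
    _ = _ := by rw [← h₄, Category.id_comp]

end VanishingHomotopy

/-! ### From regular weak kernels to monomorphisms -/

section Splitting

variable {C : Type u} [Category.{v} C] [Preadditive C] [IsIdempotentComplete C]

/-- If a weak kernel has a von Neumann regular weak kernel, then it can be replaced by a
monomorphism. -/
lemma exists_mono_isWeakKernel_of_regular {W K X Y : C} {d : W ⟶ K} {k : K ⟶ X} {f : X ⟶ Y}
    (hd : IsWeakKernel d k) (hk : IsWeakKernel k f) (ψ : K ⟶ W) (hψ : d ≫ ψ ≫ d = d) :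
    ∃ (V : C) (l : V ⟶ X), Mono l ∧ IsWeakKernel l f := by
  -- `ψ ≫ d` is an idempotent with the same image as `d`, and `V` is the complementary summand.
  -- Since everything killed by `k` factors through `d`, restricting `k` to `V` makes it mono, and
  -- nothing is lost because `d ≫ k = 0`.
  obtain ⟨V, ι, π, h₁, h₂⟩ := IsIdempotentComplete.idempotents_split K (𝟙 K - ψ ≫ d)
    (by simp [hψ])
  have hdπ : d ≫ π = 0 := by
    have : d ≫ π ≫ ι = 0 := by rw [h₂]; simp [hψ]
    rw [← Category.comp_id π, ← h₁, reassoc_of% this, zero_comp]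
  refine ⟨V, ι ≫ k, ?_, IsWeakKernel.mk (by simp [hk.w]) fun A a ha => ?_⟩
  · refine Preadditive.mono_of_cancel_zero _ fun {A} a ha => ?_
    obtain ⟨b, hb⟩ := hd.exists_lift (a ≫ ι) (by simpa using ha)
    rw [← Category.comp_id a, ← h₁, ← reassoc_of% hb, hdπ, comp_zero]
  · obtain ⟨l, rfl⟩ := hk.exists_lift a ha
    exact ⟨l ≫ π, by simp [reassoc_of% h₂, hd.w]⟩

/-- A category with weak kernels and `n`-cokernels, where `0 < n`, has `n`-kernels. -/
lemma HasWeakKernels.hasNKernels {n : ℕ} (hn : 0 < n) (h : HasWeakKernels C)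
    (h' : HasNCokernels C n) : HasNKernels C n := by
  intro X Y f
  obtain ⟨m, rfl⟩ : ∃ m, n = m + 1 := ⟨n - 1, by lia⟩
  obtain ⟨S, hS, hS'⟩ := h.exists_isWeakKernelSeq m f
  obtain ⟨K, k, hk⟩ := h (S.map' 0 1)
  obtain ⟨W, d, hd⟩ := h k
  obtain ⟨W', d', hd'⟩ := h d
  -- Three extra weak kernels give the required `n + 3` morphisms and put `d` in second place.
  obtain ⟨ψ, hψ⟩ := h'.exists_regular
    (T := ((S.precomp k).precomp (X := W) d).precomp (X := W') d')
    (((hS'.precomp k hk).precomp (X := W) d hd).precomp (X := W') d' hd')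
  obtain ⟨V, l, hl, hl'⟩ := exists_mono_isWeakKernel_of_regular hd hk ψ hψ
  exact ⟨S.precomp l, hS, (isNKernelSeq_iff _).2 ⟨hl, hS'.precomp l hl'⟩⟩

end Splitting
-- Dimension shifting and vanishing of `Ext` into projectives
section ExtVanishing

universe w

open Abelian

variable {A : Type u} [Category.{v} A] [Abelian A]

section

variable [HasExt.{w} A] {S : ShortComplex A} (hS : S.ShortExact) [Projective S.X₂] (P : A)

include hS

lemma subsingleton_ext_add_two_iff (j : ℕ) :
    Subsingleton (Ext.{w} S.X₃ P (j + 2)) ↔ Subsingleton (Ext.{w} S.X₁ P (j + 1)) := by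
  constructor
  · refine fun h => subsingleton_of_forall_eq 0 fun x => ?_
    obtain ⟨y, rfl⟩ := Ext.contravariant_sequence_exact₁ hS P x (n₁ := j + 2) (by lia)
      (Subsingleton.elim _ _)
    rw [y.eq_zero_of_projective, Ext.comp_zero]
  · refine fun h => subsingleton_of_forall_eq 0 fun x => ?_
    obtain ⟨y, rfl⟩ := Ext.contravariant_sequence_exact₃ hS P x
      (Ext.eq_zero_of_projective _) (n₀ := j + 1) (by lia)
    rw [Subsingleton.elim y 0, Ext.comp_zero]

lemma subsingleton_ext_one_iff :
    Subsingleton (Ext.{w} S.X₃ P 1) ↔ ∀ x : S.X₁ ⟶ P, ∃ y : S.X₂ ⟶ P, S.f ≫ y = x := by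
  constructor
  · intro h x
    obtain ⟨y, hy⟩ := Ext.contravariant_sequence_exact₁ hS P (Ext.mk₀ x) (n₁ := 1) (by lia)
      (Subsingleton.elim _ _)
    obtain ⟨y, rfl⟩ := (Ext.mk₀_bijective _ _).2 y
    rw [Ext.mk₀_comp_mk₀] at hy
    exact ⟨y, (Ext.mk₀_bijective _ _).1 hy⟩
  · refine fun h => subsingleton_of_forall_eq 0 fun x => ?_
    obtain ⟨y, rfl⟩ := Ext.contravariant_sequence_exact₃ hS P x
      (Ext.eq_zero_of_projective _) (n₀ := 0) (by lia)
    obtain ⟨y, rfl⟩ := (Ext.mk₀_bijective _ _).2 y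
    obtain ⟨z, rfl⟩ := h y
    rw [← Ext.mk₀_comp_mk₀, hS.extClass_comp_assoc]

end

lemma subsingleton_ext_of_retract [HasExt.{w} A] {X P Q : A} (r : Retract P Q) (i : ℕ)
    (h : Subsingleton (Ext.{w} X Q i)) : Subsingleton (Ext.{w} X P i) := by
  refine subsingleton_of_forall_eq 0 fun x => ?_
  have : (x.comp (Ext.mk₀ r.i) (add_zero i)).comp (Ext.mk₀ r.r) (add_zero i) = x := by
    rw [Ext.comp_assoc_of_second_deg_zero, Ext.mk₀_comp_mk₀, r.retract, Ext.comp_mk₀_id]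
  rw [← this, Subsingleton.elim (x.comp _ _) 0, Ext.zero_comp]

/-- If `X` has projective dimension at most `d` and `Extᵈ(X, P)` vanishes for all projective
objects `P`, then the projective dimension of `X` is smaller than `d`. -/
lemma hasProjectiveDimensionLT_of_ext_projective [HasExt.{w} A] [EnoughProjectives A] {X : A}
    (d : ℕ) [HasProjectiveDimensionLT X (d + 1)]
    (h : ∀ P : A, Projective P → Subsingleton (Ext.{w} X P d)) :
    HasProjectiveDimensionLT X d := by
  rw [hasProjectiveDimensionLT_iff.{w}]
  intro i hi Y x
  obtain hi | rfl := hi.lt_or_eq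
  · exact x.eq_zero_of_hasProjectiveDimensionLT (d + 1) hi
  · have hS : (ShortComplex.mk (kernel.ι (Projective.π Y)) (Projective.π Y) (by simp)).ShortExact :=
      { exact := ShortComplex.exact_kernel _ }
    -- As `Extᵈ⁺¹(X, -)` vanishes, `Extᵈ(X, -)` preserves epimorphisms, so `x` comes from a
    -- projective mapping onto `Y`.
    obtain ⟨y, rfl⟩ := Ext.covariant_sequence_exact₃ X hS x (n₁ := d + 1) rfl
      (Ext.eq_zero_of_hasProjectiveDimensionLT _ (d + 1) le_rfl)
    have := h (Projective.over Y) inferInstance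
    rw [Subsingleton.elim y 0, Ext.zero_comp]

/-- Each vanishing group lowers the bound on the projective dimension by one, until nothing is left.
-/
lemma isZero_of_ext_projective [HasExt.{w} A] [EnoughProjectives A] {X : A}
    (d : ℕ) (hX : HasProjectiveDimensionLT X d)
    (h : ∀ i < d, ∀ P : A, Projective P → Subsingleton (Ext.{w} X P i)) : IsZero X := by
  induction d with
  | zero => exact isZero_of_hasProjectiveDimensionLT_zero X
  | succ d ih =>
    exact ih (hasProjectiveDimensionLT_of_ext_projective d (h d (by lia)))
      fun i hi => h i (by lia)

end ExtVanishing

/-! ### Global dimension and grade through vanishing conditions -/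

section Grade

variable {A : Type u} [Category.{v} A] [Abelian A]

lemma gldim_le_iff (n : ℕ) :
    gldim A ≤ (n : WithBot ℕ∞) + 1 ↔ ∀ X : A, HasProjectiveDimensionLT X (n + 2) := by
  rw [gldim, iSup_le_iff]
  refine forall_congr' fun X => ?_
  have := projectiveDimension_le_iff X (n + 1)
  push_cast at this
  exact this

/-- The groups `Extⁱ(X, P)` vanish for all projective objects `P`. -/
def ExtProjectiveVanishes (X : A) (i : ℕ) : Prop :=
  letI := HasExt.standard A
  ∀ P : A, Projective P → Subsingleton (Abelian.Ext.{max u v} X P i)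

lemma lt_grade_iff (X : A) (n : ℕ) :
    (n : ℕ∞) < grade X ↔ ∀ i ≤ n, ExtProjectiveVanishes X i := by
  have : grade X = ⨆ j ∈ {j : ℕ | ∀ i < j, ExtProjectiveVanishes X i}, (j : ℕ∞) := rfl
  simp only [this, lt_iSup_iff, Set.mem_ofPred_eq, exists_prop, Nat.cast_lt]
  constructor
  · rintro ⟨j, hj, hn⟩ i hi
    exact hj i (by lia)
  · intro h
    exact ⟨n + 1, fun i hi => h i (by lia), by lia⟩

lemma grade_eq_zero_iff (X : A) : grade X = 0 ↔ ¬ ExtProjectiveVanishes X 0 := by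
  have := lt_grade_iff X 0
  rw [← not_iff_not, ← ne_eq, ← pos_iff_ne_zero, not_not]
  simpa using this

lemma grade_eq_add_one_iff (X : A) (n : ℕ) : grade X = (n : ℕ∞) + 1 ↔
    (∀ i ≤ n, ExtProjectiveVanishes X i) ∧ ¬ ∀ i ≤ n + 1, ExtProjectiveVanishes X i := by
  rw [← lt_grade_iff, ← lt_grade_iff, not_lt, le_antisymm_iff, and_comm]
  push_cast
  rw [ENat.add_one_le_iff (ENat.natCast_ne_top n)]

end Grade
-- Presentation functors: weak kernels and projective dimension
section PresentationFunctor

universe w v' u'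

open Abelian

variable {C : Type u} [Category.{v} C] {A : Type u'} [Category.{v'} A] [Abelian A]

/-- The functor `h` takes values in projective objects and every object is the cokernel of a
morphism in the image of `h`. -/
structure IsPresentationFunctor (h : C ⥤ A) : Prop where
  projective : ∀ X : C, Projective (h.obj X)
  exists_iso : ∀ F : A, ∃ (X Y : C) (f : X ⟶ Y), Nonempty (cokernel (h.map f) ≅ F)

namespace IsPresentationFunctor

variable {h : C ⥤ A} (hh : IsPresentationFunctor h)

include hh

lemma exists_epi (F : A) : ∃ (X : C) (p : h.obj X ⟶ F), Epi p := by
  obtain ⟨X, Y, f, ⟨e⟩⟩ := hh.exists_iso F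
  exact ⟨Y, cokernel.π _ ≫ e.hom, inferInstance⟩

lemma enoughProjectives : EnoughProjectives A where
  presentation F := by
    obtain ⟨X, p, hp⟩ := hh.exists_epi F
    exact ⟨{ p := h.obj X, projective := hh.projective X, f := p, epi := hp }⟩

lemma exists_retract (P : A) [Projective P] : ∃ X : C, Nonempty (Retract P (h.obj X)) := by
  obtain ⟨X, p, hp⟩ := hh.exists_epi P
  exact ⟨X, ⟨{ i := Projective.factorThru (𝟙 P) p, r := p }⟩⟩

variable [h.Full] [h.Faithful]

/-- A section `s` of the cokernel projection `π` makes `𝟙 - π ≫ s` land in the image of `h(d)`; it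
lifts through `h(d)` since `h(K)` is projective, and precomposing with `h(d)` kills the correction
term. -/
lemma exists_regular_of_projective {W K : C} (d : W ⟶ K) [Projective (cokernel (h.map d))] :
    ∃ ψ : K ⟶ W, d ≫ ψ ≫ d = d := by
  have := hh.projective K
  let s := Projective.factorThru (𝟙 _) (cokernel.π (h.map d))
  have hs : s ≫ cokernel.π (h.map d) = 𝟙 _ := Projective.factorThru_comp _ _
  have hb : (𝟙 _ - cokernel.π (h.map d) ≫ s) ≫ cokernel.π (h.map d) = 0 := by simp [hs]
  let ψ := (ShortComplex.exact_cokernel (h.map d)).liftFromProjective _ hb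
  have hψ : ψ ≫ h.map d = 𝟙 _ - cokernel.π (h.map d) ≫ s :=
    (ShortComplex.exact_cokernel (h.map d)).liftFromProjective_comp _ hb
  refine ⟨h.preimage ψ, h.map_injective ?_⟩
  simp [hψ]

variable [Preadditive C]

lemma hasWeakKernels : HasWeakKernels C := by
  intro X Y f
  obtain ⟨K, p, hp⟩ := hh.exists_epi (kernel (h.map f))
  have hp' : h.map (h.preimage (p ≫ kernel.ι _)) = p ≫ kernel.ι _ := h.map_preimage _
  have := h.preservesZeroMorphisms_of_full
  refine ⟨K, h.preimage (p ≫ kernel.ι _), IsWeakKernel.mk (h.map_injective ?_) fun B b hb => ?_⟩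
  · rw [h.map_comp, hp']
    simp
  · have := hh.projective B
    refine ⟨h.preimage (Projective.factorThru (kernel.lift (h.map f) (h.map b) ?_) p),
      h.map_injective ?_⟩
    · rw [← h.map_comp, hb, h.map_zero]
    · rw [h.map_comp, hp', h.map_preimage, Projective.factorThru_comp_assoc, kernel.lift_ι]

variable [h.Additive]

/-- Exactness can be tested on the objects `h(B)`, as they are projective and cover every object;
full faithfulness moves the test to `C`. -/
lemma isWeakKernel_iff {K X Y : C} (k : K ⟶ X) (f : X ⟶ Y) :
    IsWeakKernel k f ↔
      ∃ w : h.map k ≫ h.map f = 0, (ShortComplex.mk (h.map k) (h.map f) w).Exact := by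
  constructor
  · intro hk
    refine ⟨by rw [← h.map_comp, hk.w, h.map_zero], ?_⟩
    rw [ShortComplex.exact_iff_exact_up_to_refinements]
    intro B b hb
    obtain ⟨W, p, hp⟩ := hh.exists_epi B
    obtain ⟨l, hl⟩ := hk.exists_lift (h.preimage (p ≫ b)) (h.map_injective (by
      dsimp at hb
      rw [h.map_comp, h.map_preimage, Category.assoc, hb, comp_zero, h.map_zero]))
    exact ⟨h.obj W, p, hp, h.map l, by dsimp; rw [← h.map_comp, hl, h.map_preimage]⟩
  · rintro ⟨w, hw⟩
    refine IsWeakKernel.mk (h.map_injective (by rw [h.map_comp, w, h.map_zero])) fun B b hb => ?_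
    have := hh.projective B
    have hb' : h.map b ≫ h.map f = 0 := by rw [← h.map_comp, hb, h.map_zero]
    refine ⟨h.preimage (hw.liftFromProjective (h.map b) hb'), h.map_injective ?_⟩
    rw [h.map_comp, h.map_preimage]
    exact hw.liftFromProjective_comp _ _

/-- The exact sequence `0 ⟶ coker h(k) ⟶ h(Y) ⟶ coker h(f) ⟶ 0` for a weak kernel `k` of
`f : X ⟶ Y`. -/
lemma shortExact {K X Y : C} {k : K ⟶ X} {f : X ⟶ Y} (hk : IsWeakKernel k f) :
    ∃ w : h.map k ≫ h.map f = 0, (ShortComplex.mk (cokernel.desc (h.map k) (h.map f) w)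
      (cokernel.π (h.map f)) (by simp [← cancel_epi (cokernel.π (h.map k))])).ShortExact := by
  obtain ⟨w, hw⟩ := (hh.isWeakKernel_iff k f).1 hk
  refine ⟨w, ?_⟩
  exact {
    exact := by
      have := ShortComplex.exact_cokernel (h.map f)
      rw [ShortComplex.exact_iff_exact_up_to_refinements] at this ⊢
      intro B b hb
      obtain ⟨B', p, hp, x, hx⟩ := this b hb
      exact ⟨B', p, hp, x ≫ cokernel.π _, by simpa using hx⟩
    mono_f := hw.mono_cokernelDesc
    epi_g := inferInstanceAs (Epi (cokernel.π (h.map f))) }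

lemma hasProjectiveDimensionLT_iff {K X Y : C} {k : K ⟶ X} {f : X ⟶ Y} (hk : IsWeakKernel k f)
    (d : ℕ) : HasProjectiveDimensionLT (cokernel (h.map f)) (d + 2) ↔
      HasProjectiveDimensionLT (cokernel (h.map k)) (d + 1) := by
  obtain ⟨w, hw⟩ := hh.shortExact hk
  exact hw.hasProjectiveDimensionLT_X₃_iff d (hh.projective Y)

lemma hasProjectiveDimensionLT_of_mono {X Y : C} (f : X ⟶ Y) [Mono f] :
    HasProjectiveDimensionLT (cokernel (h.map f)) 2 := by
  have hk : IsWeakKernel (0 : X ⟶ X) f := IsWeakKernel.mk (by simp) fun B b hb =>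
    ⟨0, by rw [zero_comp, zero_of_comp_mono f hb]⟩
  rw [hh.hasProjectiveDimensionLT_iff hk 0]
  have := hh.projective X
  have e : h.obj X ≅ cokernel (h.map (0 : X ⟶ X)) :=
    (cokernelZeroIsoTarget (X := h.obj X)).symm ≪≫ cokernelIsoOfEq (h.map_zero X X).symm
  exact hasProjectiveDimensionLT_of_iso e 1

lemma hasProjectiveDimensionLT_of_isWeakKernelSeq {n : ℕ} {S : ComposableArrows C (n + 1)}
    (hS : IsWeakKernelSeq S) (d j : ℕ) (hj : j ≤ n) :
    HasProjectiveDimensionLT (cokernel (h.map (S.map' j (j + 1)))) (d + j + 1) ↔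
      HasProjectiveDimensionLT (cokernel (h.map (S.map' 0 1))) (d + 1) := by
  induction j with
  | zero => rfl
  | succ j ih =>
    rw [← ih (by lia)]
    exact hh.hasProjectiveDimensionLT_iff (hS j (by lia)) (d + j)

/-- An `n`-kernel yields a projective resolution. -/
lemma hasProjectiveDimensionLT_of_hasNKernels {n : ℕ} (hC : HasNKernels C n) (F : A) :
    HasProjectiveDimensionLT F (n + 2) := by
  obtain ⟨X, Y, f, ⟨e⟩⟩ := hh.exists_iso F
  refine @hasProjectiveDimensionLT_of_iso _ _ _ _ _ e _ ?_
  obtain ⟨S, hS, hS'⟩ := hC f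
  refine (iff_of_arrow_eq (fun X Y f => HasProjectiveDimensionLT (cokernel (h.map f)) (n + 2))
    hS).1 ?_
  obtain ⟨_, hS'⟩ := (isNKernelSeq_iff S).1 hS'
  have := (hh.hasProjectiveDimensionLT_of_isWeakKernelSeq hS' 1 n le_rfl).2
    (hh.hasProjectiveDimensionLT_of_mono _)
  rwa [show 1 + n + 1 = n + 2 by lia] at this

/-- If the projective dimensions are at most `n + 1`, where `0 < n`, then the weak kernels can be
used to construct `n`-kernels. -/
lemma hasNKernels [IsIdempotentComplete C] {n : ℕ} (hn : 0 < n)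
    (hA : ∀ F : A, HasProjectiveDimensionLT F (n + 2)) : HasNKernels C n := by
  intro X Y f
  obtain ⟨m, rfl⟩ : ∃ m, n = m + 1 := ⟨n - 1, by lia⟩
  have hC := hh.hasWeakKernels
  obtain ⟨S, hS, hS'⟩ := hC.exists_isWeakKernelSeq m f
  obtain ⟨K, k, hk⟩ := hC (S.map' 0 1)
  obtain ⟨W, d, hd⟩ := hC k
  have h₁ := hA (cokernel (h.map (S.map' m (m + 1))))
  -- Shifting along `S`, then `k`, then `d`, uses up the whole bound and leaves `coker h(d)` with
  -- projective dimension below `1`.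
  rw [show m + 1 + 2 = 2 + m + 1 by lia,
    hh.hasProjectiveDimensionLT_of_isWeakKernelSeq hS' 2 m le_rfl,
    hh.hasProjectiveDimensionLT_iff hk 1, hh.hasProjectiveDimensionLT_iff hd 0] at h₁
  have : Projective (cokernel (h.map d)) := inferInstance
  obtain ⟨ψ, hψ⟩ := hh.exists_regular_of_projective d
  obtain ⟨V, l, hl, hl'⟩ := exists_mono_isWeakKernel_of_regular hd hk ψ hψ
  exact ⟨S.precomp l, hS, (isNKernelSeq_iff _).2 ⟨hl, hS'.precomp l hl'⟩⟩

end IsPresentationFunctor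

end PresentationFunctor
-- Presentation functors: `Ext` and grade
section PresentationFunctor

universe v' u'

open Abelian

variable {C : Type u} [Category.{v} C] {A : Type u'} [Category.{v'} A] [Abelian A]

lemma ExtProjectiveVanishes.of_iso {X Y : A} (e : X ≅ Y) {i : ℕ}
    (h : ExtProjectiveVanishes X i) : ExtProjectiveVanishes Y i := by
  let := HasExt.standard A
  refine fun P hP => subsingleton_of_forall_eq 0 fun x => ?_
  have : Subsingleton (Ext.{max u' v'} X P i) := h P hP
  have h₁ : (Ext.mk₀ e.inv).comp ((Ext.mk₀ e.hom).comp x (zero_add i)) (zero_add i) = x := by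
    rw [Ext.mk₀_comp_mk₀_assoc, e.inv_hom_id, Ext.mk₀_id_comp]
  rw [← h₁, Subsingleton.elim ((Ext.mk₀ e.hom).comp x (zero_add i)) 0, Ext.comp_zero]

namespace IsPresentationFunctor

variable {h : C ⥤ A} (hh : IsPresentationFunctor h)

include hh

lemma extProjectiveVanishes_iff (F : A) (i : ℕ) :
    ExtProjectiveVanishes F i ↔ ∀ Z : C, letI := HasExt.standard A
      Subsingleton (Ext.{max u' v'} F (h.obj Z) i) := by
  let := HasExt.standard A
  constructor
  · exact fun H Z => H _ (hh.projective Z)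
  · intro H P hP
    obtain ⟨Z, ⟨r⟩⟩ := hh.exists_retract P
    exact subsingleton_ext_of_retract r i (H Z)

variable [Preadditive C] [h.Full] [h.Faithful] [h.Additive]

/-- Maps `coker h(f) ⟶ h(Z)` are the `z : Y ⟶ Z` with `f ≫ z = 0`. -/
lemma extProjectiveVanishes_zero_iff {X Y : C} (f : X ⟶ Y) :
    ExtProjectiveVanishes (cokernel (h.map f)) 0 ↔ Epi f := by
  let := HasExt.standard A
  rw [hh.extProjectiveVanishes_iff]
  simp only [Ext.homEquiv₀.subsingleton_congr]
  constructor
  · refine fun H => Preadditive.epi_of_cancel_zero _ fun {Z} z hz => h.map_injective ?_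
    have := H Z
    rw [← cokernel.π_desc (h.map f) (h.map z) (by rw [← h.map_comp, hz, h.map_zero]),
      Subsingleton.elim (cokernel.desc _ _ _) 0, comp_zero, h.map_zero]
  · refine fun H Z => subsingleton_of_forall_eq 0 fun x => ?_
    rw [← cancel_epi (cokernel.π (h.map f)), comp_zero, ← h.map_preimage (cokernel.π _ ≫ x),
      (cancel_epi f).1 (h.map_injective (a₁ := f ≫ h.preimage (cokernel.π _ ≫ x)) (a₂ := f ≫ 0) _),
      h.map_zero]
    simp

/-- With `coker h(k)` as the syzygy inside `h(Y)`, vanishing means that every `x : X ⟶ Z` with `k ≫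
x = 0` extends along `f`. -/
lemma subsingleton_ext_one_iff [HasExt.{max u' v'} A] {K X Y : C} {k : K ⟶ X} {f : X ⟶ Y}
    (hk : IsWeakKernel k f) (Z : C) :
    Subsingleton (Ext.{max u' v'} (cokernel (h.map f)) (h.obj Z) 1) ↔
      Function.Exact (fun y : Y ⟶ Z => f ≫ y) (fun x : X ⟶ Z => k ≫ x) := by
  obtain ⟨w, hw⟩ := hh.shortExact hk
  have := hh.projective Y
  have key := HigherAbelian.subsingleton_ext_one_iff hw (h.obj Z)
  refine key.trans ⟨fun H x => ⟨fun hx => ?_, ?_⟩, fun H x => ?_⟩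
  · obtain ⟨y, hy⟩ := H (cokernel.desc (h.map k) (h.map x)
      (by
      dsimp only at hx
      rw [← h.map_comp, hx, h.map_zero]))
    refine ⟨h.preimage y, h.map_injective ?_⟩
    have := congrArg (fun t => cokernel.π (h.map k) ≫ t) hy
    simpa using this
  · rintro ⟨y, rfl⟩
    simp [reassoc_of% hk.w]
  · obtain ⟨y, hy⟩ := (H (h.preimage (cokernel.π (h.map k) ≫ x))).1 (h.map_injective (by simp))
    refine ⟨h.map y, ?_⟩
    have := congrArg h.map hy
    rw [← cancel_epi (cokernel.π (h.map k))]
    simpa using this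

lemma subsingleton_ext_iff_of_isWeakKernelSeq [HasExt.{max u' v'} A] {n : ℕ}
    {S : ComposableArrows C (n + 1)} (hS : IsWeakKernelSeq S) (P : A) (i j : ℕ) (hij : i + j ≤ n) :
    Subsingleton (Ext.{max u' v'} (cokernel (h.map (S.map' (i + j) (i + j + 1)))) P (j + 1)) ↔
      Subsingleton (Ext.{max u' v'} (cokernel (h.map (S.map' i (i + 1)))) P 1) := by
  induction j with
  | zero => rfl
  | succ j ih =>
    rw [← ih (by lia)]
    obtain ⟨w, hw⟩ := hh.shortExact (hS (i + j) (by lia))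
    have := hh.projective (S.obj' (i + j + 2))
    exact subsingleton_ext_add_two_iff hw P j

/-- A sequence of weak kernels is an `n`-cokernel sequence if and only if suitable `Ext`-groups
of the cokernel of its last morphism vanish. -/
lemma isNCokernelSeq_iff {n : ℕ} {S : ComposableArrows C (n + 1)} (hS : IsWeakKernelSeq S) :
    IsNCokernelSeq S ↔
      ∀ i ≤ n, ExtProjectiveVanishes (cokernel (h.map (S.map' n (n + 1)))) i := by
  let := HasExt.standard A
  constructor
  · rintro hS' (_ | j) hj
    · exact (hh.extProjectiveVanishes_zero_iff _).2
        ((forall_injective_comp_iff_epi _).1 hS'.injective)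
    · rw [hh.extProjectiveVanishes_iff]
      intro Z
      obtain ⟨i, rfl⟩ : ∃ i, n = i + 1 + j := ⟨n - j - 1, by lia⟩
      exact (hh.subsingleton_ext_iff_of_isWeakKernelSeq hS _ (i + 1) j le_rfl).2
        ((hh.subsingleton_ext_one_iff (hS i (by lia)) Z).2 (hS'.exact i (by lia) Z))
  · refine fun H => ⟨?_, fun i hi Z => ?_⟩
    · exact (forall_injective_comp_iff_epi _).2
        ((hh.extProjectiveVanishes_zero_iff _).1 (H 0 (by lia)))
    · obtain ⟨j, rfl⟩ : ∃ j, n = i + 1 + j := ⟨n - i - 1, by lia⟩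
      exact (hh.subsingleton_ext_one_iff (hS i (by lia)) Z).1
        ((hh.subsingleton_ext_iff_of_isWeakKernelSeq hS _ (i + 1) j le_rfl).1
          ((hh.extProjectiveVanishes_iff _ _).1 (H (j + 1) (by lia)) Z))

/-- In presence of `n`-kernels, nonzero objects have grade `0` or `n + 1` if and only if `n`-kernels
of epimorphisms give rise to `n`-cokernels. -/
lemma grade_iff {n : ℕ} (hC : HasNKernels C n) :
    (∀ F : A, ¬ IsZero F → grade F = 0 ∨ grade F = (n : ℕ∞) + 1) ↔
      NKernelsOfEpiAreNCokernels C n := by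
  constructor
  · intro H S hS hS'
    rw [hh.isNCokernelSeq_iff ((isNKernelSeq_iff S).1 hS').2]
    -- The grade hypothesis covers nonzero objects only; for a zero object all `Ext` groups vanish
    -- anyway.
    by_cases hF : IsZero (cokernel (h.map (S.map' n (n + 1))))
    · intro i _
      let := HasExt.standard A
      refine fun P hP => subsingleton_of_forall_eq 0 fun x => ?_
      rw [← Ext.mk₀_id_comp x, hF.eq_of_src (𝟙 _) 0, Ext.mk₀_zero, Ext.zero_comp]
    · rcases H _ hF with hF' | hF'
      · rw [grade_eq_zero_iff, hh.extProjectiveVanishes_zero_iff] at hF'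
        exact absurd hS hF'
      · exact ((grade_eq_add_one_iff _ _).1 hF').1
  · intro H F hF
    rw [grade_eq_zero_iff, grade_eq_add_one_iff, or_iff_not_imp_left, not_not]
    intro h₀
    obtain ⟨X, Y, f, ⟨e⟩⟩ := hh.exists_iso F
    have hf : Epi f := (hh.extProjectiveVanishes_zero_iff f).1 (h₀.of_iso e.symm)
    obtain ⟨S, hS, hS'⟩ := hC f
    constructor
    · have h₁ := (hh.isNCokernelSeq_iff ((isNKernelSeq_iff S).1 hS').2).1
        (H S ((iff_of_arrow_eq (fun _ _ f => Epi f) hS).2 hf) hS')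
      have h₂ := (iff_of_arrow_eq (fun _ _ f => ∀ i ≤ n,
        ExtProjectiveVanishes (cokernel (h.map f)) i) hS).1 h₁
      exact fun i hi => (h₂ i hi).of_iso e
    · intro h₁
      let := HasExt.standard A
      have := hh.enoughProjectives
      -- Vanishing up to degree `n + 1` exhausts the projective dimension, which the `n`-kernels
      -- keep below `n + 2`.
      exact hF (isZero_of_ext_projective (n + 2) (hh.hasProjectiveDimensionLT_of_hasNKernels hC F)
        fun i hi => h₁ i (by lia))

end IsPresentationFunctor

end PresentationFunctor
-- Finitely presented modules
section Modules

open Opposite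

variable {C : Type u} [Category.{v} C] [Preadditive C]

/-- The element of `F(A)` that a morphism `p : C(-, Y) ⟶ F` assigns to `g : A ⟶ Y`. -/
def ev {Y : C} {F : Cᵒᵖ ⥤ AddCommGrpCat.{v}} (p : preadditiveYoneda.obj Y ⟶ F) {A : C}
    (g : A ⟶ Y) : F.obj (op A) :=
  p.app (op A) g

section

variable {Y : C} {F G : Cᵒᵖ ⥤ AddCommGrpCat.{v}} (p : preadditiveYoneda.obj Y ⟶ F)

lemma ev_add {A : C} (g g' : A ⟶ Y) : ev p (g + g') = ev p g + ev p g' :=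
  map_add (p.app (op A)).hom (g : (preadditiveYoneda.obj Y).obj (op A)) g'

lemma ev_zero (A : C) : ev p (0 : A ⟶ Y) = 0 :=
  map_zero (p.app (op A)).hom

lemma ev_sub {A : C} (g g' : A ⟶ Y) : ev p (g - g') = ev p g - ev p g' :=
  map_sub (p.app (op A)).hom (g : (preadditiveYoneda.obj Y).obj (op A)) g'

lemma ev_comp {A B : C} (b : B ⟶ A) (g : A ⟶ Y) : ev p (b ≫ g) = F.map b.op (ev p g) :=
  ConcreteCategory.congr_hom (p.naturality b.op) (g : (preadditiveYoneda.obj Y).obj (op A))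

lemma ev_eq_map {A : C} (g : A ⟶ Y) : ev p g = F.map g.op (ev p (𝟙 Y)) := by
  rw [← ev_comp, Category.comp_id]

lemma ev_comp_app (φ : F ⟶ G) {A : C} (g : A ⟶ Y) : ev (p ≫ φ) g = φ.app (op A) (ev p g) := rfl

/-- The morphism `C(-, Y) ⟶ F` corresponding to an element of `F(Y)`. -/
def ofElement (F : Cᵒᵖ ⥤ AddCommGrpCat.{v}) [F.Additive] {Y : C} (x : F.obj (op Y)) :
    preadditiveYoneda.obj Y ⟶ F where
  app A := AddCommGrpCat.ofHom (AddMonoidHom.mk' (fun g : A.unop ⟶ Y => F.map g.op x)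
    fun g g' => by
      have h : F.map (Quiver.Hom.op (X := A.unop) (Y := Y) (g + g')) =
        F.map (Quiver.Hom.op (X := A.unop) g) + F.map (Quiver.Hom.op (X := A.unop) g') := F.map_add
      exact ConcreteCategory.congr_hom h x)
  naturality A B b := by
    ext g
    exact ConcreteCategory.congr_hom (F.map_comp (Quiver.Hom.op (X := A.unop) (Y := Y) g) b) x

lemma ev_ofElement (F : Cᵒᵖ ⥤ AddCommGrpCat.{v}) [F.Additive] {Y : C} (x : F.obj (op Y))
    {A : C} (g : A ⟶ Y) : ev (ofElement F x) g = F.map g.op x := rfl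

end

/-- `C(-, X) ⟶ C(-, Y) ⟶ F ⟶ 0` is exact. -/
structure IsPresentation {X Y : C} (f : X ⟶ Y) {F : Cᵒᵖ ⥤ AddCommGrpCat.{v}}
    (p : preadditiveYoneda.obj Y ⟶ F) : Prop where
  ev_eq_zero_iff : ∀ {A : C} (g : A ⟶ Y), ev p g = 0 ↔ ∃ l : A ⟶ X, l ≫ f = g
  exists_ev_eq : ∀ {A : C} (t : F.obj (op A)), ∃ g : A ⟶ Y, ev p g = t

lemma isFinitelyPresented_iff (F : Cᵒᵖ ⥤ AddCommGrpCat.{v}) : isFinitelyPresented C F ↔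
    F.Additive ∧ ∃ (X Y : C) (f : X ⟶ Y) (p : preadditiveYoneda.obj Y ⟶ F), IsPresentation f p :=
  and_congr Iff.rfl (exists_congr fun _ => exists_congr fun _ => exists_congr fun _ =>
    exists_congr fun _ => ⟨fun h => ⟨fun {A} => (h (op A)).1, fun {A} => (h (op A)).2⟩,
      fun h A => ⟨h.1 (A := A.unop), h.2 (A := A.unop)⟩⟩)

/-- Kernels and cokernels are formed among all functors, so additivity has to be inherited by
quotients and subfunctors. -/
lemma additive_of_surjective {F G : Cᵒᵖ ⥤ AddCommGrpCat.{v}} [F.Additive] (φ : F ⟶ G)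
    (hφ : ∀ A, Function.Surjective (φ.app A)) : G.Additive where
  map_add {A B f g} := by
    ext t
    obtain ⟨s, rfl⟩ := hφ A t
    have nat : ∀ k : A ⟶ B, G.map k (φ.app A s) = φ.app B (F.map k s) := fun k =>
      (ConcreteCategory.congr_hom (φ.naturality k) s).symm
    change G.map (f + g) _ = G.map f _ + G.map g _
    rw [nat, nat, nat, F.map_add, ← map_add]
    rfl

lemma additive_of_injective {F G : Cᵒᵖ ⥤ AddCommGrpCat.{v}} [G.Additive] (φ : F ⟶ G)
    (hφ : ∀ A, Function.Injective (φ.app A)) : F.Additive where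
  map_add {A B f g} := by
    ext s
    apply hφ
    have nat : ∀ k : A ⟶ B, G.map k (φ.app A s) = φ.app B (F.map k s) := fun k =>
      (ConcreteCategory.congr_hom (φ.naturality k) s).symm
    change φ.app B _ = φ.app B (F.map f s + F.map g s)
    rw [map_add, ← nat, ← nat, ← nat, G.map_add]
    rfl

lemma isPresentation_id (Y : C) : IsPresentation (0 : Y ⟶ Y) (𝟙 (preadditiveYoneda.obj Y)) where
  ev_eq_zero_iff {A} g := by
    refine ⟨fun h => ⟨0, ?_⟩, ?_⟩
    · rw [zero_comp]; exact h.symm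
    · rintro ⟨l, rfl⟩
      rw [comp_zero, ev_zero]
  exists_ev_eq t := ⟨t, rfl⟩

lemma isFinitelyPresented_yoneda (Y : C) :
    isFinitelyPresented C (preadditiveYoneda.obj Y) :=
  (isFinitelyPresented_iff _).2 ⟨inferInstance, _, _, _, _, isPresentation_id Y⟩

variable (C) in
/-- The Yoneda embedding of `C` into the category of finitely presented modules. -/
abbrev fpYoneda : C ⥤ FPMod C :=
  (isFinitelyPresented C).lift preadditiveYoneda isFinitelyPresented_yoneda

instance : (fpYoneda C).Additive where
  map_add {X Y f g} := by
    ext A x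
    exact Preadditive.comp_add _ _ _ (x : A.unop ⟶ X) f g

lemma exists_isColimit_fpYoneda (F : FPMod C) : ∃ (X Y : C) (f : X ⟶ Y)
    (p : (fpYoneda C).obj Y ⟶ F) (w : (fpYoneda C).map f ≫ p = 0),
      Nonempty (IsColimit (CokernelCofork.ofπ p w)) := by
  obtain ⟨_, X, Y, f, p, hp⟩ := F.property
  have w : preadditiveYoneda.map f ≫ p = 0 := by
    ext A x
    exact ((hp A).1 _).2 ⟨x, rfl⟩
  refine ⟨X, Y, f, ObjectProperty.homMk p, ObjectProperty.hom_ext _ w, ⟨?_⟩⟩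
  have h : IsColimit (CokernelCofork.ofπ p w) := evaluationJointlyReflectsColimits _ fun A => by
    have ex : (ShortComplex.mk _ _ (NatTrans.congr_app w A)).Exact :=
      (ShortComplex.ab_exact_iff_function_exact _).2 (hp A).1
    have : Epi (p.app A) := (AddCommGrpCat.epi_iff_surjective _).2 (hp A).2
    exact (CokernelCofork.isColimitMapCoconeEquiv (CokernelCofork.ofπ p w)
      ((evaluation _ _).obj A)).symm ex.gIsCokernel
  exact isColimitOfReflects (isFinitelyPresented C).ι
    ((CokernelCofork.isColimitMapCoconeEquiv _ _).symm h)

variable [HasFiniteBiproducts C]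

lemma isFinitelyPresented_of_exact_of_surjective {F G Q : Cᵒᵖ ⥤ AddCommGrpCat.{v}} {φ : F ⟶ G}
    {π : G ⟶ Q} (hF : isFinitelyPresented C F) (hG : isFinitelyPresented C G)
    (hπ : ∀ A, Function.Exact (φ.app A) (π.app A)) (hπ' : ∀ A, Function.Surjective (π.app A)) :
    isFinitelyPresented C Q := by
  have := hasBinaryBiproducts_of_finite_biproducts C
  rw [isFinitelyPresented_iff] at hF hG ⊢
  obtain ⟨_, X₁, X₀, f, p, hp⟩ := hF
  obtain ⟨_, Y₁, Y₀, g, q, hq⟩ := hG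
  refine ⟨additive_of_surjective π hπ', ?_⟩
  obtain ⟨a, ha⟩ := hq.exists_ev_eq (φ.app _ (ev p (𝟙 X₀)))
  have ha' : ∀ {A : C} (x : A ⟶ X₀), ev q (x ≫ a) = φ.app _ (ev p x) := fun x => by
    rw [ev_comp, ha, ← ev_comp_app, ← ev_comp_app, ← ev_comp, Category.comp_id]
  -- With `a` lifting `φ` to generators, the relations of `Q` are those of `G` together with the
  -- image of the generators of `F`.
  refine ⟨X₀ ⊞ Y₁, Y₀, biprod.desc a g, q ≫ π, ⟨fun {A} y => ⟨fun hy => ?_, ?_⟩, fun t => ?_⟩⟩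
  · rw [ev_comp_app] at hy
    obtain ⟨t, ht⟩ := (hπ _ _).1 hy
    obtain ⟨x, rfl⟩ := hp.exists_ev_eq t
    obtain ⟨z, hz⟩ := (hq.ev_eq_zero_iff (y - x ≫ a)).1 (by rw [ev_sub, ha', ht, sub_self])
    exact ⟨biprod.lift x z, by rw [biprod.lift_desc, hz]; abel⟩
  · rintro ⟨l, rfl⟩
    have h₁ : l ≫ biprod.desc a g = (l ≫ biprod.fst) ≫ a + (l ≫ biprod.snd) ≫ g := by
      simp [biprod.desc_eq]
    have h₂ : ev q ((l ≫ biprod.snd) ≫ g) = 0 := (hq.ev_eq_zero_iff _).2 ⟨_, rfl⟩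
    rw [ev_comp_app, h₁, ev_add, h₂, add_zero, ha']
    exact (hπ _ _).2 ⟨_, rfl⟩
  · obtain ⟨s, rfl⟩ := hπ' _ t
    obtain ⟨y, rfl⟩ := hq.exists_ev_eq s
    exact ⟨y, rfl⟩

lemma isFinitelyPresented_of_exact_of_injective (hC : HasWeakKernels C)
    {K F G : Cᵒᵖ ⥤ AddCommGrpCat.{v}} {ι : K ⟶ F} {φ : F ⟶ G} (hF : isFinitelyPresented C F)
    (hG : isFinitelyPresented C G) (hι : ∀ A, Function.Exact (ι.app A) (φ.app A))
    (hι' : ∀ A, Function.Injective (ι.app A)) : isFinitelyPresented C K := by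
  rw [isFinitelyPresented_iff] at hF hG ⊢
  obtain ⟨_, X₁, X₀, f, p, hp⟩ := hF
  obtain ⟨_, Y₁, Y₀, g, q, hq⟩ := hG
  have := additive_of_injective ι hι'
  refine ⟨inferInstance, ?_⟩
  obtain ⟨a, ha⟩ := hq.exists_ev_eq (φ.app _ (ev p (𝟙 X₀)))
  have ha' : ∀ {A : C} (x : A ⟶ X₀), ev q (x ≫ a) = φ.app _ (ev p x) := fun x => by
    rw [ev_comp, ha, ← ev_comp_app, ← ev_comp_app, ← ev_comp, Category.comp_id]
  -- `W` parametrises generators of `F` whose image under `φ` vanishes, hence generators of `K`; the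
  -- second weak pullback `V` finds which of them are already relations in `F`.
  obtain ⟨W, w, z, hwz, hW⟩ := hC.exists_weakPullback a g
  obtain ⟨V, b, c, hbc, hV⟩ := hC.exists_weakPullback w f
  obtain ⟨κ, hκ⟩ := (hι _ (ev p w)).1 (by
    rw [← ha', hwz]
    exact (hq.ev_eq_zero_iff _).2 ⟨_, rfl⟩)
  have hκ' : ∀ {A : C} (l : A ⟶ W), ι.app _ (ev (ofElement K κ) l) = ev p (l ≫ w) := fun l => by
    rw [ev_ofElement, ev_comp, ← hκ]
    exact ConcreteCategory.congr_hom (ι.naturality l.op) κ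
  refine ⟨V, W, b, ofElement K κ, ⟨fun {A} l => ?_, fun {A} t => ?_⟩⟩
  · rw [← (hι' (op A)).eq_iff, hκ', map_zero, hp.ev_eq_zero_iff]
    constructor
    · rintro ⟨m, hm⟩
      obtain ⟨n, hn, -⟩ := hV A l m hm.symm
      exact ⟨n, hn⟩
    · rintro ⟨n, rfl⟩
      exact ⟨n ≫ c, by simp [hbc]⟩
  · obtain ⟨x, hx⟩ := hp.exists_ev_eq (ι.app _ t)
    obtain ⟨m, hm⟩ := (hq.ev_eq_zero_iff (x ≫ a)).1 (by
      rw [ha', hx]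
      exact (hι _ _).2 ⟨t, rfl⟩)
    obtain ⟨l, hl, -⟩ := hW A x m hm.symm
    exact ⟨l, hι' _ (by rw [hκ', hl, hx])⟩

instance isClosedUnderCokernels_isFinitelyPresented :
    (isFinitelyPresented C).IsClosedUnderCokernels where
  cokernels_le := by
    rintro _ ⟨φ, k, hk, hF, hG⟩
    have : Epi k.π := Cofork.IsColimit.epi hk
    have ex : (ShortComplex.mk φ k.π k.condition).Exact :=
      ShortComplex.exact_of_g_is_cokernel _ (hk.ofIsoColimit (Cofork.ext (Iso.refl _)))
    refine isFinitelyPresented_of_exact_of_surjective hF hG (φ := φ) (π := k.π) (fun A => ?_)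
      fun A => ?_
    · exact (ShortComplex.ab_exact_iff_function_exact _).1 (ex.map ((evaluation _ _).obj A))
    · rw [← AddCommGrpCat.epi_iff_surjective]
      infer_instance

lemma isClosedUnderKernels_isFinitelyPresented (hC : HasWeakKernels C) :
    (isFinitelyPresented C).IsClosedUnderKernels where
  kernels_le := by
    rintro _ ⟨φ, k, hk, hF, hG⟩
    have : Mono k.ι := Fork.IsLimit.mono hk
    have ex : (ShortComplex.mk k.ι φ k.condition).Exact :=
      ShortComplex.exact_of_f_is_kernel _ (hk.ofIsoLimit (Fork.ext (Iso.refl _)))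
    refine isFinitelyPresented_of_exact_of_injective hC hF hG (φ := φ) (ι := k.ι) (fun A => ?_)
      fun A => ?_
    · exact (ShortComplex.ab_exact_iff_function_exact _).1 (ex.map ((evaluation _ _).obj A))
    · rw [← AddCommGrpCat.mono_iff_injective]
      infer_instance

instance isClosedUnderIsomorphisms_isFinitelyPresented :
    (isFinitelyPresented C).IsClosedUnderIsomorphisms where
  of_iso {F G} e hF := by
    have bij : ∀ A, Function.Bijective (e.hom.app A) := fun A =>
      ConcreteCategory.bijective_of_isIso (e.hom.app A)
    refine isFinitelyPresented_of_exact_of_surjective hF hF (φ := 0) (fun A x => ?_)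
      fun A => (bij A).2
    rw [← map_zero (e.hom.app A).hom]
    exact (bij A).1.eq_iff.trans ⟨fun h => ⟨0, h.symm⟩, fun ⟨_, h⟩ => h.symm⟩

lemma isFinitelyPresented_biprod {F G : Cᵒᵖ ⥤ AddCommGrpCat.{v}}
    (hF : isFinitelyPresented C F) (hG : isFinitelyPresented C G) :
    isFinitelyPresented C (F ⊞ G) := by
  have := hasBinaryBiproducts_of_finite_biproducts C
  rw [isFinitelyPresented_iff] at hF hG ⊢
  obtain ⟨_, X₁, X₀, f, p, hp⟩ := hF
  obtain ⟨_, Y₁, Y₀, g, q, hq⟩ := hG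
  have e₁ : ∀ A x, (biprod.fst : F ⊞ G ⟶ F).app A ((biprod.inl : F ⟶ F ⊞ G).app A x) = x :=
    fun A x => ConcreteCategory.congr_hom (NatTrans.congr_app biprod.inl_fst A) x
  have e₂ : ∀ A x, (biprod.fst : F ⊞ G ⟶ F).app A ((biprod.inr : G ⟶ F ⊞ G).app A x) = 0 :=
    fun A x => ConcreteCategory.congr_hom (NatTrans.congr_app biprod.inr_fst A) x
  have e₃ : ∀ A x, (biprod.snd : F ⊞ G ⟶ G).app A ((biprod.inl : F ⟶ F ⊞ G).app A x) = 0 :=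
    fun A x => ConcreteCategory.congr_hom (NatTrans.congr_app biprod.inl_snd A) x
  have e₄ : ∀ A x, (biprod.snd : F ⊞ G ⟶ G).app A ((biprod.inr : G ⟶ F ⊞ G).app A x) = x :=
    fun A x => ConcreteCategory.congr_hom (NatTrans.congr_app biprod.inr_snd A) x
  have e₅ : ∀ A t, (biprod.inl : F ⟶ F ⊞ G).app A ((biprod.fst : F ⊞ G ⟶ F).app A t) +
      (biprod.inr : G ⟶ F ⊞ G).app A ((biprod.snd : F ⊞ G ⟶ G).app A t) = t :=
    fun A t => ConcreteCategory.congr_hom (NatTrans.congr_app (biprod.total (X := F) (Y := G)) A) t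
  let r : preadditiveYoneda.obj (X₀ ⊞ Y₀) ⟶ F ⊞ G :=
    preadditiveYoneda.map biprod.fst ≫ p ≫ biprod.inl +
      preadditiveYoneda.map biprod.snd ≫ q ≫ biprod.inr
  have hr : ∀ {A : C} (y : A ⟶ X₀ ⊞ Y₀), ev r y =
      (biprod.inl : F ⟶ F ⊞ G).app (op A) (ev p (y ≫ biprod.fst)) +
      (biprod.inr : G ⟶ F ⊞ G).app (op A) (ev q (y ≫ biprod.snd)) := fun y => rfl
  have hr' : ∀ {A : C} (y : A ⟶ X₀ ⊞ Y₀), ev r y = 0 ↔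
      ev p (y ≫ biprod.fst) = 0 ∧ ev q (y ≫ biprod.snd) = 0 := fun y => by
    rw [hr]
    refine ⟨fun h => ⟨?_, ?_⟩, fun ⟨h, h'⟩ => by rw [h, h', map_zero, map_zero, add_zero]⟩
    · have := congrArg ((biprod.fst : F ⊞ G ⟶ F).app _) h
      rwa [map_add, e₁, e₂, add_zero, map_zero] at this
    · have := congrArg ((biprod.snd : F ⊞ G ⟶ G).app _) h
      rwa [map_add, e₃, e₄, zero_add, map_zero] at this
  have hs : ∀ {A : C} (t : (F ⊞ G).obj (op A)), ∃ y : A ⟶ X₀ ⊞ Y₀, ev r y = t := fun t => by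
    obtain ⟨x, hx⟩ := hp.exists_ev_eq ((biprod.fst : F ⊞ G ⟶ F).app _ t)
    obtain ⟨y, hy⟩ := hq.exists_ev_eq ((biprod.snd : F ⊞ G ⟶ G).app _ t)
    exact ⟨biprod.lift x y, by rw [hr, biprod.lift_fst, biprod.lift_snd, hx, hy, e₅]⟩
  refine ⟨additive_of_surjective r fun A => hs (A := A.unop), X₁ ⊞ Y₁, X₀ ⊞ Y₀, biprod.map f g, r,
    fun {A} y => ?_, hs⟩
  rw [hr', hp.ev_eq_zero_iff, hq.ev_eq_zero_iff]
  constructor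
  · rintro ⟨⟨x, hx⟩, z, hz⟩
    exact ⟨biprod.lift x z, by ext <;> simp [hx, hz]⟩
  · rintro ⟨l, rfl⟩
    exact ⟨⟨l ≫ biprod.fst, by simp⟩, l ≫ biprod.snd, by simp⟩

instance containsZero_isFinitelyPresented : (isFinitelyPresented C).ContainsZero where
  exists_zero := by
    have := (preadditiveYoneda (C := C)).preservesZeroMorphisms_of_full
    have := hasZeroObject_of_hasFiniteBiproducts C
    obtain ⟨Z, hZ⟩ := HasZeroObject.zero (C := C)
    exact ⟨_, preadditiveYoneda.map_isZero hZ, isFinitelyPresented_yoneda Z⟩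

instance isClosedUnderFiniteProducts_isFinitelyPresented :
    (isFinitelyPresented C).IsClosedUnderFiniteProducts := by
  have : (isFinitelyPresented C).IsClosedUnderBinaryProducts := .mk' (by
    rintro _ ⟨D, hD⟩
    exact ObjectProperty.prop_of_iso _
      (biprod.isoProd _ _ ≪≫ (HasLimit.isoOfNatIso (diagramIsoPair D)).symm)
      (isFinitelyPresented_biprod (hD ⟨.left⟩) (hD ⟨.right⟩)))
  exact .mk'

/-- A full subcategory of the functor category closed under kernels, cokernels and finite products
inherits the abelian structure. -/
lemma HasWeakKernels.isAbelianCategory (hC : HasWeakKernels C) :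
    IsAbelianCategory (FPMod C) := by
  have := isClosedUnderKernels_isFinitelyPresented hC
  exact ⟨inferInstance, inferInstance, inferInstance, inferInstance, inferInstance⟩

/-- The objectwise cokernel is again finitely presented, so an epimorphism of `FPMod C` already has
zero cokernel among functors. No kernels are involved. -/
lemma surjective_of_epi {F G : FPMod C} (e : F ⟶ G) [Epi e] (A : Cᵒᵖ) :
    Function.Surjective (e.hom.app A) := by
  have : Epi e.hom := by
    let π : G ⟶ ⟨cokernel e.hom, ObjectProperty.prop_cokernel _ e.hom F.property G.property⟩ :=
      ObjectProperty.homMk (cokernel.π e.hom)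
    have hπ : π = 0 := by
      rw [← cancel_epi e, comp_zero]
      exact ObjectProperty.hom_ext _ (cokernel.condition e.hom)
    exact Preadditive.epi_of_cokernel_zero (congrArg (fun f => f.hom) hπ)
  rw [← AddCommGrpCat.epi_iff_surjective]
  infer_instance

lemma projective_fpYoneda_obj (X : C) : Projective ((fpYoneda C).obj X) where
  factors {F G} f e _ := by
    have := F.property.1
    have := G.property.1
    obtain ⟨x, hx⟩ := surjective_of_epi e (op X) (ev f.hom (𝟙 X))
    refine ⟨ObjectProperty.homMk (ofElement F.obj x), ?_⟩
    ext A g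
    have h : e.hom.app A (F.obj.map (Quiver.Hom.op (X := A.unop) (Y := X) g) x) =
        G.obj.map (Quiver.Hom.op (X := A.unop) (Y := X) g) (e.hom.app (op X) x) :=
      ConcreteCategory.congr_hom (e.hom.naturality _) x
    rw [hx] at h
    exact h.trans (ev_eq_map f.hom (A := A.unop) g).symm

lemma IsAbelianCategory.isPresentationFunctor_fpYoneda (hA : IsAbelianCategory (FPMod C)) :
    letI : Abelian (FPMod C) := hA.abelian
    IsPresentationFunctor (fpYoneda C) := by
  let : Abelian (FPMod C) := hA.abelian
  refine ⟨projective_fpYoneda_obj, fun F => ?_⟩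
  obtain ⟨X, Y, f, p, w, ⟨h⟩⟩ := exists_isColimit_fpYoneda F
  exact ⟨X, Y, f, ⟨(cokernelIsCokernel _).coconePointUniqueUpToIso h⟩⟩

end Modules
-- The equivalence
section Main

variable {C : Type u} [Category.{v} C] [Preadditive C] [HasFiniteBiproducts C] {n : ℕ}

lemma isAbelianCategory_fpMod_iff : IsAbelianCategory (FPMod C) ↔ HasWeakKernels C :=
  ⟨fun h => let _ : Abelian (FPMod C) := h.abelian
    h.isPresentationFunctor_fpYoneda.hasWeakKernels, fun h => h.isAbelianCategory⟩

lemma gldim_fpMod_le_iff [IsIdempotentComplete C] (hn : 0 < n)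
    (h : IsAbelianCategory (FPMod C)) :
    letI : Abelian (FPMod C) := h.abelian
    gldim (FPMod C) ≤ (n : WithBot ℕ∞) + 1 ↔ HasNKernels C n := by
  let _ : Abelian (FPMod C) := h.abelian
  have hh := h.isPresentationFunctor_fpYoneda
  exact (gldim_le_iff n).trans
    ⟨fun H => hh.hasNKernels hn H, fun H => hh.hasProjectiveDimensionLT_of_hasNKernels H⟩

lemma grade_fpMod_iff (h : IsAbelianCategory (FPMod C)) (hC : HasNKernels C n) :
    letI : Abelian (FPMod C) := h.abelian
    (∀ F : FPMod C, ¬ IsZero F → grade F = 0 ∨ grade F = (n : ℕ∞) + 1) ↔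
      NKernelsOfEpiAreNCokernels C n :=
  let _ : Abelian (FPMod C) := h.abelian
  h.isPresentationFunctor_fpYoneda.grade_iff hC

end Main
end HigherAbelian

open HigherAbelian in
/-- An additive and idempotent complete category `C` is `n`-abelian if and only if it is coherent,
`gldim (mod C) ≤ n + 1`, and every nonzero object of `mod C` and of `mod Cᵒᵖ` has grade either `0`
or `n + 1`. -/
theorem theorem14 {C : Type u} [Category.{v} C] [Preadditive C] [HasFiniteBiproducts C]
    [IsIdempotentComplete C] (n : ℕ) (hn : 0 < n) :
    IsNAbelian C n ↔
      ∃ h : IsCoherent C,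
        letI : Abelian (FPMod C) := h.right.abelian
        letI : Abelian (FPMod Cᵒᵖ) := h.left.abelian
        gldim (FPMod C) ≤ (n : WithBot ℕ∞) + 1 ∧
        (∀ F : FPMod C, ¬ IsZero F → grade F = 0 ∨ grade F = (n : ℕ∞) + 1) ∧
        (∀ G : FPMod Cᵒᵖ, ¬ IsZero G → grade G = 0 ∨ grade G = (n : ℕ∞) + 1) := by
  have : HasFiniteBiproducts Cᵒᵖ := HasFiniteBiproducts.of_hasFiniteProducts
  have : IsIdempotentComplete Cᵒᵖ := Idempotents.isIdempotentComplete_iff_opposite.2 ‹_›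
  constructor
  · intro H
    have h₁ := H.hasNKernels
    have h₂ := H.hasNCokernels.op
    have hr := isAbelianCategory_fpMod_iff.2 (h₁.hasWeakKernels hn)
    have hl := isAbelianCategory_fpMod_iff.2 (h₂.hasWeakKernels hn)
    exact ⟨⟨hr, hl⟩, (gldim_fpMod_le_iff hn hr).2 h₁,
      (grade_fpMod_iff hr h₁).2 H.isNCokernelSeq_of_epi,
      (grade_fpMod_iff hl h₂).2 H.nKernelsOfEpiAreNCokernels_op⟩
  · rintro ⟨⟨hr, hl⟩, hd, hg, hg'⟩
    have h₁ := (gldim_fpMod_le_iff hn hr).1 hd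
    -- No dimension bound is available for `mod Cᵒᵖ`: left coherence gives weak kernels in `Cᵒᵖ`,
    -- and the `n`-cokernels dual to `h₁` upgrade them to `n`-kernels.
    have h₂ := (isAbelianCategory_fpMod_iff.1 hl).hasNKernels hn h₁.op
    exact ⟨h₁, h₂.unop, ((grade_fpMod_iff hl h₂).1 hg').isNKernelSeq_of_mono,
      (grade_fpMod_iff hr h₁).1 hg⟩
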